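/- Fix an integer base $b\ge 2$. For a real number $\alpha\in(1,2)$ let $y_0=\alpha$ and, for $n\ge 0$, let $$a_n=\lfloor \log_b y_n\rfloor,\qquad c_n=\left\lfloor \frac{y_n}{b^{a_n}}\right\rfloor,\qquad y_{n+1}=\frac{b^{a_n}}{y_n-c_nb^{a_n}},$$ where the process stops at the first $n$ (if any) with $y_n=c_nb^{a_n}$. (The terms $c_nb^{a_n}$, with $a_n\in\mathbb Z_{\ge 0}$ and $c_n\in\{1,\dots,b-1\}$, are the terms of the type III base $b$ continued logarithm of $\alpha$.) Let $f:\mathbb Z_{\ge 0}\times\{1,\dots,b-1\}\to\mathbb R$ be a nonnegative function for which there exist constants $C,\delta>0$ such that $$f(s,t)<C\,(t\,b^s)^{\frac12-\delta}\qquad\text{for all } s\in\mathbb Z_{\ge 0},\ t\in\{1,\dots,b-1\}.$$ Then the series on the right-hand side below converges and, for Lebesgue-almost every $\alpha\in(1,2)$, the process does not stop and $$\lim_{N\to\infty}\frac1N\sum_{n=1}^N f(a_n,c_n)=\sum_{k=0}^\infty\sum_{\ell=1}^{b-1} f(k,\ell)\,\frac{\log\dfrac{(1+\ell^{-1}b^{-k})(b+(\ell+1)^{-1}b^{-k})}{(b+\ell^{-1}b^{-k})(1+(\ell+1)^{-1}b^{-k})}}{\log\dfrac{2b}{b+1}}.$$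 -/

import Mathlib

open MeasureTheory Filter Topology

noncomputable section

/-- The exponent `⌊log_b y⌋` of the leading base `b` term of a real number `y ≥ 1`
(for `y ≥ 1` this integer is nonnegative). -/
def clogExponent (b : ℕ) (y : ℝ) : ℕ := ⌊Real.logb (b : ℝ) y⌋₊

/-- The leading coefficient `⌊y / b ^ ⌊log_b y⌋⌋` of a real number `y ≥ 1`. -/
def clogCoeff (b : ℕ) (y : ℝ) : ℕ := ⌊y / (b : ℝ) ^ clogExponent b y⌋₊

/-- The remainders `y_n` of the type III base `b` continued logarithm of `α`:
`y_0 = α` and `y_{n+1} = b ^ a_n / (y_n - c_n * b ^ a_n)`.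
The expansion stops at the first `n` with `y_n = c_n * b ^ a_n`; the values given here
to the later remainders have no meaning. -/
def clogRemainder (b : ℕ) (α : ℝ) : ℕ → ℝ
  | 0 => α
  | n + 1 =>
    (b : ℝ) ^ clogExponent b (clogRemainder b α n) /
      (clogRemainder b α n -
        (clogCoeff b (clogRemainder b α n) : ℝ) *
          (b : ℝ) ^ clogExponent b (clogRemainder b α n))

/-- The exponents `a_n = ⌊log_b y_n⌋` of the type III continued logarithm of `α`. -/
def clogA (b : ℕ) (α : ℝ) (n : ℕ) : ℕ := clogExponent b (clogRemainder b α n)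

/-- The coefficients `c_n = ⌊y_n / b ^ a_n⌋` of the type III continued logarithm of `α`. -/
def clogC (b : ℕ) (α : ℝ) (n : ℕ) : ℕ := clogCoeff b (clogRemainder b α n)

/-- The type III base `b` continued logarithm of `α` stops at some term. -/
def ClogTerminates (b : ℕ) (α : ℝ) : Prop :=
  ∃ n, clogRemainder b α n = (clogC b α n : ℝ) * (b : ℝ) ^ clogA b α n

/-- The limiting probability of the digit `(k, l)`, that is, of the term `l * b ^ k`. -/
def clogDigitProb (b k l : ℕ) : ℝ :=
  Real.log
      (((1 + (l : ℝ)⁻¹ * ((b : ℝ) ^ k)⁻¹) * (b + ((l : ℝ) + 1)⁻¹ * ((b : ℝ) ^ k)⁻¹)) /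
        ((b + (l : ℝ)⁻¹ * ((b : ℝ) ^ k)⁻¹) * (1 + ((l : ℝ) + 1)⁻¹ * ((b : ℝ) ^ k)⁻¹))) /
    Real.log (2 * b / (b + 1))

end

/-!
The first term of `α ∈ (1, 2)` is `1`, and after it the reciprocals of the remainders form the
orbit of `x = α - 1` under the continued logarithm map `clogMap b` of the unit interval, a relative
of the Gauss map. Its inverse branches are `x ↦ 1 / (b ^ k * (l + x))`, and `(k, l)` is the digit
read off at `1 / x`. The theorem is a law of large numbers for a function of the digits along this
orbit, started from Lebesgue measure.

The branches permute, up to factors, the probability densities `(1 + t) / (1 + t * x) ^ 2`,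
`t ∈ [0, 1]` (`clogKernel`), which include Lebesgue measure as `t = 0`: if `x` has density
`clogKernel t`, the first digit is `i` with an explicit probability `i.weight t`, and given this
digit the image point has density `clogKernel (i.param t)` (`hasSum_clogExpect`). Hence
expectations along the orbit are computed by iterating the averaging operator
`a ↦ (t ↦ ∑ i, i.weight t * a (i.param t))`. This operator contracts Lipschitz constants by the
factor `1 - 1 / (4 b)` (`abs_sub_le_of_hasSum_weight`): moving the parameters inside the branches
costs at most `3 / 4`, and the change of the weights, which is controlled by a telescoping sum,
costs at most `(1 - 1 / b) / 4`.

The measure with density `1 / (1 + x) - 1 / (b + x)` is invariant (`measurePreserving_clogMap`)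
and is a mixture of the densities `clogKernel t`, so it determines the limit of these expectations
(`abs_clogExpect_iterate_le`). For a function of the digit with mean zero this makes the
covariances decay exponentially (`abs_integral_mul_iterate_le`). The growth condition on `f`
makes it square integrable (`memLp_firstDigitFun`), so the partial sums have
variance `O(N)`. Chebyshev's inequality along geometric subsequences and the monotonicity of the
partial sums give almost sure convergence (`ae_tendsto_average_of_covariance_decay`), and
integrating the invariant density over the points with a given digit identifies the limit
(`hasSum_clogDigitProb`).
-/

noncomputable section

/-! ### Branches of the continued logarithm map -/

/-- Index set of the terms `(j + 1) * b ^ k`, with `(k, j)` standing for the exponent `k` and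
the coefficient `j + 1 ∈ {1, …, b - 1}`. -/
abbrev ClogDigit (b : ℕ) : Type := ℕ × Fin (b - 1)

namespace ClogDigit

variable {b : ℕ}

/-- The power `b ^ k` belonging to a digit. -/
def scale (i : ClogDigit b) : ℝ := (b : ℝ) ^ i.1

/-- The coefficient of a digit, as a real number. -/
def coeff (i : ClogDigit b) : ℝ := (i.2 : ℕ) + 1

/-- The inverse branch `x ↦ 1 / (b ^ k * (l + x))` of the continued logarithm map. -/
def branch (i : ClogDigit b) (x : ℝ) : ℝ := (i.scale * (i.coeff + x))⁻¹

lemma two_le (i : ClogDigit b) : 2 ≤ b := by have := i.2.2; omega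

lemma one_le_scale (i : ClogDigit b) : 1 ≤ i.scale :=
  one_le_pow₀ (by have := i.two_le; exact_mod_cast (by omega : 1 ≤ b))

lemma scale_pos (i : ClogDigit b) : 0 < i.scale := zero_lt_one.trans_le i.one_le_scale

lemma one_le_coeff (i : ClogDigit b) : 1 ≤ i.coeff := by simp [coeff]

lemma coeff_add_one_le (i : ClogDigit b) : i.coeff + 1 ≤ b := by
  have := i.2.2
  have h : (i.2 : ℕ) + 1 + 1 ≤ b := by omega
  unfold coeff
  exact_mod_cast h

end ClogDigit

open ClogDigit

/-- The continued logarithm map on the unit interval, acting on reciprocals of remainders: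
if `x = 1 / y_n` then `clogMap b x = 1 / y_{n+1}`. The value `0` means that the expansion stops. -/
def clogMap (b : ℕ) (x : ℝ) : ℝ :=
  x⁻¹ / (b : ℝ) ^ clogExponent b x⁻¹ - clogCoeff b x⁻¹

section digits

variable {b : ℕ}

lemma clogExponent_eq (hb : 2 ≤ b) {y : ℝ} {k : ℕ} (h1 : (b : ℝ) ^ k ≤ y)
    (h2 : y < (b : ℝ) ^ (k + 1)) : clogExponent b y = k := by
  have hb1 : (1 : ℝ) < b := by exact_mod_cast (by omega : 1 < b)
  have hy : 0 < y := lt_of_lt_of_le (by positivity) h1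
  have hk : (k : ℝ) ≤ Real.logb b y := by
    rw [Real.le_logb_iff_rpow_le hb1 hy, Real.rpow_natCast]; exact h1
  rw [clogExponent, Nat.floor_eq_iff (le_trans (by positivity) hk)]
  refine ⟨hk, ?_⟩
  rw [Real.logb_lt_iff_lt_rpow hb1 hy]
  exact_mod_cast h2

lemma pow_clogExponent_le (hb : 2 ≤ b) {y : ℝ} (hy : 1 ≤ y) :
    (b : ℝ) ^ clogExponent b y ≤ y ∧ y < (b : ℝ) ^ (clogExponent b y + 1) := by
  have hb1 : (1 : ℝ) < b := by exact_mod_cast (by omega : 1 < b)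
  have hy0 : 0 < y := by linarith
  have h0 : 0 ≤ Real.logb b y := Real.logb_nonneg hb1 hy
  constructor
  · have := Nat.floor_le h0
    rwa [Real.le_logb_iff_rpow_le hb1 hy0, Real.rpow_natCast] at this
  · have := Nat.lt_floor_add_one (Real.logb b y)
    rw [Real.logb_lt_iff_lt_rpow hb1 hy0] at this
    exact_mod_cast this

lemma ClogDigit.bounds (i : ClogDigit b) {x : ℝ} (hx : x ∈ Set.Ico (0 : ℝ) 1) :
    (b : ℝ) ^ i.1 ≤ i.scale * (i.coeff + x) ∧ i.scale * (i.coeff + x) < (b : ℝ) ^ (i.1 + 1) := by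
  have h1 := i.scale_pos
  have h2 := i.one_le_coeff
  have h3 := i.coeff_add_one_le
  have h4 : (b : ℝ) ^ i.1 = i.scale := rfl
  rw [pow_succ, h4]
  constructor
  · nlinarith [hx.1]
  · exact mul_lt_mul_of_pos_left (by linarith [hx.2]) h1

lemma clogExponent_branch (i : ClogDigit b) {x : ℝ} (hx : x ∈ Set.Ico (0 : ℝ) 1) :
    clogExponent b (i.branch x)⁻¹ = i.1 := by
  rw [branch, inv_inv]
  exact clogExponent_eq i.two_le (i.bounds hx).1 (i.bounds hx).2

lemma clogCoeff_branch (i : ClogDigit b) {x : ℝ} (hx : x ∈ Set.Ico (0 : ℝ) 1) :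
    clogCoeff b (i.branch x)⁻¹ = i.2 + 1 := by
  have h1 := i.scale_pos
  have h4 : (b : ℝ) ^ i.1 = i.scale := rfl
  rw [clogCoeff, clogExponent_branch i hx, branch, inv_inv, h4, mul_div_cancel_left₀ _ h1.ne',
    Nat.floor_eq_iff (by have := i.one_le_coeff; linarith [hx.1]), coeff]
  push_cast
  exact ⟨by linarith [hx.1], by linarith [hx.2]⟩

lemma clogMap_branch (i : ClogDigit b) {x : ℝ} (hx : x ∈ Set.Ico (0 : ℝ) 1) :
    clogMap b (i.branch x) = x := by
  have h1 := i.scale_pos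
  have h4 : (b : ℝ) ^ i.1 = i.scale := rfl
  rw [clogMap, clogCoeff_branch i hx, clogExponent_branch i hx, branch, inv_inv, h4,
    mul_div_cancel_left₀ _ h1.ne', coeff]
  push_cast
  ring

lemma branch_mem_Ioo (i : ClogDigit b) {x : ℝ} (hx : x ∈ Set.Ioo (0 : ℝ) 1) :
    i.branch x ∈ Set.Ioo (0 : ℝ) 1 := by
  have h1 := i.one_le_scale
  have h2 := i.one_le_coeff
  have h3 : 1 < i.scale * (i.coeff + x) := by nlinarith [hx.1]
  exact ⟨inv_pos.2 (by linarith), inv_lt_one_of_one_lt₀ h3⟩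

lemma clogCoeff_mem (hb : 2 ≤ b) {y : ℝ} (hy : 1 ≤ y) :
    1 ≤ clogCoeff b y ∧ clogCoeff b y ≤ b - 1 := by
  obtain ⟨h1, h2⟩ := pow_clogExponent_le hb hy
  have hpos : 0 < (b : ℝ) ^ clogExponent b y :=
    pow_pos (by exact_mod_cast (by omega : 0 < b)) _
  constructor
  · rw [clogCoeff, Nat.one_le_floor_iff, le_div_iff₀ hpos]; linarith
  · have : clogCoeff b y < b := by
      rw [clogCoeff, Nat.floor_lt (by positivity), div_lt_iff₀ hpos]
      rw [pow_succ] at h2; linarith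
    omega

lemma clogMap_mem_Ico (x : ℝ) (hx : 0 ≤ x) : clogMap b x ∈ Set.Ico (0 : ℝ) 1 := by
  have h0 : 0 ≤ x⁻¹ / (b : ℝ) ^ clogExponent b x⁻¹ := by positivity
  refine ⟨sub_nonneg.2 (Nat.floor_le h0), ?_⟩
  have := Nat.lt_floor_add_one (x⁻¹ / (b : ℝ) ^ clogExponent b x⁻¹)
  rw [clogMap, clogCoeff]; linarith

lemma exists_branch_eq (hb : 2 ≤ b) {x : ℝ} (hx : x ∈ Set.Ioo (0 : ℝ) 1) :
    ∃ i : ClogDigit b, i.branch (clogMap b x) = x := by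
  have hy : 1 ≤ x⁻¹ := (one_le_inv₀ hx.1).2 hx.2.le
  have hc := clogCoeff_mem hb hy
  have hpos : 0 < (b : ℝ) ^ clogExponent b x⁻¹ :=
    pow_pos (by exact_mod_cast (by omega : 0 < b)) _
  refine ⟨(clogExponent b x⁻¹, ⟨clogCoeff b x⁻¹ - 1, by omega⟩), ?_⟩
  have h1 : ((clogCoeff b x⁻¹ - 1 : ℕ) : ℝ) + 1 = clogCoeff b x⁻¹ := by
    exact_mod_cast Nat.sub_add_cancel hc.1
  simp only [branch, scale, coeff, h1, clogMap]
  rw [add_sub_cancel, mul_div_cancel₀ _ hpos.ne', inv_inv]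

end digits

section changeOfVariables

variable {b : ℕ}

lemma hasDerivAt_branch (i : ClogDigit b) {x : ℝ} (hx : 0 ≤ x) :
    HasDerivAt i.branch (-(i.scale * (i.coeff + x) ^ 2)⁻¹) x := by
  have h1 := i.scale_pos
  have h2 := i.one_le_coeff
  have h3 : i.coeff + x ≠ 0 := by linarith
  have h4 : HasDerivAt (fun x => i.scale * (i.coeff + x)) (i.scale * 1) x :=
    ((hasDerivAt_id x).const_add _).const_mul _
  refine (h4.inv (mul_ne_zero h1.ne' h3)).congr_deriv ?_
  have h5 := h1.ne'
  field_simp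

lemma injOn_branch (i : ClogDigit b) : Set.InjOn i.branch (Set.Ioo 0 1) := by
  intro x hx y hy h
  rw [← clogMap_branch i ⟨hx.1.le, hx.2⟩, h, clogMap_branch i ⟨hy.1.le, hy.2⟩]

lemma continuousOn_branch (i : ClogDigit b) : ContinuousOn i.branch (Set.Ioo 0 1) :=
  fun _ hx => (hasDerivAt_branch i hx.1.le).continuousAt.continuousWithinAt

lemma measurableSet_branch_image (i : ClogDigit b) :
    MeasurableSet (i.branch '' Set.Ioo 0 1) :=
  measurableSet_Ioo.image_of_continuousOn_injOn (continuousOn_branch i) (injOn_branch i)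

lemma pairwise_disjoint_branch_image :
    Pairwise (Function.onFun Disjoint fun i : ClogDigit b => i.branch '' Set.Ioo 0 1) := by
  intro i j hij
  refine Set.disjoint_left.2 ?_
  rintro _ ⟨x, hx, rfl⟩ ⟨y, hy, h⟩
  apply hij
  have hx' : x ∈ Set.Ico (0 : ℝ) 1 := ⟨hx.1.le, hx.2⟩
  have hy' : y ∈ Set.Ico (0 : ℝ) 1 := ⟨hy.1.le, hy.2⟩
  have h1 := clogExponent_branch i hx'
  have h2 := clogCoeff_branch i hx'
  rw [← h, clogExponent_branch j hy'] at h1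
  rw [← h, clogCoeff_branch j hy'] at h2
  ext
  · exact h1.symm
  · simpa using h2.symm

/-- The images of the inverse branches cover the unit interval up to the countable set of the
points with a one-term expansion. -/
lemma iUnion_branch_image_ae_eq (hb : 2 ≤ b) :
    (⋃ i : ClogDigit b, i.branch '' Set.Ioo 0 1) =ᵐ[volume] Set.Ioo (0 : ℝ) 1 := by
  have hsub : (⋃ i : ClogDigit b, i.branch '' Set.Ioo 0 1) ⊆ Set.Ioo (0 : ℝ) 1 := by
    refine Set.iUnion_subset fun i => ?_
    rintro _ ⟨x, hx, rfl⟩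
    exact branch_mem_Ioo i hx
  refine (LE.le.eventuallyLE hsub).antisymm ?_
  have hnull : volume (Set.range fun i : ClogDigit b => i.branch 0) = 0 :=
    (Set.countable_range _).measure_zero _
  filter_upwards [compl_mem_ae_iff.2 hnull] with x hx hx1
  obtain ⟨i, hi⟩ := exists_branch_eq hb hx1
  have h := clogMap_mem_Ico (b := b) x (le_of_lt hx1.1)
  have h0 : clogMap b x ≠ 0 := by
    intro h0
    rw [h0] at hi
    exact hx ⟨i, hi⟩
  exact Set.mem_iUnion.2 ⟨i, clogMap b x, ⟨lt_of_le_of_ne h.1 (Ne.symm h0), h.2⟩, hi⟩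

lemma abs_deriv_branch (i : ClogDigit b) (x : ℝ) :
    |-(i.scale * (i.coeff + x) ^ 2)⁻¹| = (i.scale * (i.coeff + x) ^ 2)⁻¹ := by
  have := i.scale_pos
  rw [abs_neg, abs_of_nonneg (by positivity)]

lemma lintegral_eq_tsum_branch (hb : 2 ≤ b) (v : ℝ → ENNReal) :
    ∫⁻ x in Set.Ioo 0 1, v x = ∑' i : ClogDigit b,
      ∫⁻ x in Set.Ioo 0 1, ENNReal.ofReal (i.scale * (i.coeff + x) ^ 2)⁻¹ * v (i.branch x) := by
  rw [← setLIntegral_congr (iUnion_branch_image_ae_eq hb),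
    lintegral_iUnion measurableSet_branch_image pairwise_disjoint_branch_image]
  refine tsum_congr fun i => ?_
  rw [lintegral_image_eq_lintegral_abs_deriv_mul measurableSet_Ioo
    (fun x hx => (hasDerivAt_branch i hx.1.le).hasDerivWithinAt) (injOn_branch i)]
  simp_rw [abs_deriv_branch]

lemma hasSum_integral_branch (hb : 2 ≤ b) {v : ℝ → ℝ} (hv : IntegrableOn v (Set.Ioo 0 1)) :
    HasSum (fun i : ClogDigit b =>
      ∫ x in Set.Ioo 0 1, (i.scale * (i.coeff + x) ^ 2)⁻¹ * v (i.branch x))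
      (∫ x in Set.Ioo 0 1, v x) := by
  have hae := iUnion_branch_image_ae_eq hb
  rw [← setIntegral_congr_set hae]
  have h := hasSum_integral_iUnion (fun i : ClogDigit b => measurableSet_branch_image i)
    pairwise_disjoint_branch_image (hv.congr_set_ae hae)
  refine h.congr_fun fun i => ?_
  rw [integral_image_eq_integral_abs_deriv_smul measurableSet_Ioo
    (fun x hx => (hasDerivAt_branch i hx.1.le).hasDerivWithinAt) (injOn_branch i)]
  simp_rw [abs_deriv_branch, smul_eq_mul]

end changeOfVariables

/-! ### The weights of the branches and their contraction -/

/-- The probability density `x ↦ (1 + t) / (1 + t * x) ^ 2` on the unit interval. -/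
def clogKernel (t x : ℝ) : ℝ := (1 + t) / (1 + t * x) ^ 2

namespace ClogDigit

variable {b : ℕ}

/-- The probability that the first digit is `i` under the density `clogKernel t`. -/
def weight (i : ClogDigit b) (t : ℝ) : ℝ :=
  (1 + t) * i.scale / ((i.scale * i.coeff + t) * (i.scale * (i.coeff + 1) + t))

/-- The parameter of the density of `clogMap b x` when `x` has density `clogKernel t` and is
conditioned to have first digit `i`. -/
def param (i : ClogDigit b) (t : ℝ) : ℝ := i.scale / (i.scale * i.coeff + t)

/-- The digit of the term `1`. -/
def first (hb : 2 ≤ b) : ClogDigit b := (0, ⟨0, by omega⟩)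

lemma scale_le_lower (i : ClogDigit b) : i.scale ≤ i.scale * i.coeff :=
  le_mul_of_one_le_right i.scale_pos.le i.one_le_coeff

lemma one_le_lower (i : ClogDigit b) : 1 ≤ i.scale * i.coeff :=
  i.one_le_scale.trans i.scale_le_lower

lemma weight_nonneg (i : ClogDigit b) {t : ℝ} (ht : 0 ≤ t) : 0 ≤ i.weight t := by
  have h1 := i.scale_pos
  have h2 := i.one_le_coeff
  unfold weight
  positivity

lemma weight_eq_sub (i : ClogDigit b) {t : ℝ} (ht : 0 ≤ t) :
    i.weight t =
      (1 + t) / (i.scale * i.coeff + t) - (1 + t) / (i.scale * (i.coeff + 1) + t) := by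
  have h1 := i.scale_pos
  have h2 := i.one_le_coeff
  have h3 : i.scale * i.coeff + t ≠ 0 := by positivity
  have h4 : i.scale * (i.coeff + 1) + t ≠ 0 := by positivity
  unfold weight
  field_simp
  ring

lemma param_le_one (i : ClogDigit b) {t : ℝ} (ht : 0 ≤ t) : i.param t ≤ 1 := by
  have h1 := i.scale_pos
  have h2 := i.scale_le_lower
  rw [param, div_le_one (by linarith)]; linarith

lemma inv_le_param (i : ClogDigit b) {t : ℝ} (ht : t ∈ Set.Icc (0 : ℝ) 1) :
    (b : ℝ)⁻¹ ≤ i.param t := by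
  have h1 := i.one_le_scale
  have h2 := i.one_le_lower
  have h3 := i.coeff_add_one_le
  have hb : (0 : ℝ) < b := by linarith [i.one_le_coeff]
  rw [param, inv_eq_one_div, div_le_div_iff₀ hb (by linarith [ht.1])]
  nlinarith [ht.2]

lemma param_mem (i : ClogDigit b) {t : ℝ} (ht : t ∈ Set.Icc (0 : ℝ) 1) :
    i.param t ∈ Set.Icc (0 : ℝ) 1 :=
  ⟨le_trans (by positivity) (i.inv_le_param ht), i.param_le_one ht.1⟩

/-- The densities `clogKernel t` are carried to multiples of such densities by the branches. -/
lemma jacobian_mul_clogKernel (i : ClogDigit b) {t x : ℝ} (ht : 0 ≤ t) (hx : 0 ≤ x) :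
    (i.scale * (i.coeff + x) ^ 2)⁻¹ * clogKernel t (i.branch x) =
      i.weight t * clogKernel (i.param t) x := by
  have h1 := i.scale_pos
  have h2 := i.one_le_coeff
  have h3 : i.scale * i.coeff + t ≠ 0 := by positivity
  have h4 : i.scale * (i.coeff + 1) + t ≠ 0 := by positivity
  have h5 : i.coeff + x ≠ 0 := by positivity
  have h6 : i.scale * (i.coeff + x) + t ≠ 0 := by positivity
  have e1 : 1 + t * i.branch x = (i.scale * (i.coeff + x) + t) / (i.scale * (i.coeff + x)) := by
    rw [branch]; field_simp
  have e2 : 1 + i.param t * x = (i.scale * (i.coeff + x) + t) / (i.scale * i.coeff + t) := by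
    rw [param]; field_simp; ring
  have e3 : 1 + i.param t = (i.scale * (i.coeff + 1) + t) / (i.scale * i.coeff + t) := by
    rw [param]; field_simp; ring
  rw [clogKernel, clogKernel, e1, e2, e3, weight]
  have h7 := h1.ne'
  field_simp

end ClogDigit

section telescoping

variable {b : ℕ}

lemma sum_fin_telescope (hb : 1 ≤ b) (σ : ℝ → ℝ) (B : ℝ) :
    ∑ j : Fin (b - 1), (σ (B * ((j : ℕ) + 1)) - σ (B * ((j : ℕ) + 1 + 1))) =
      σ B - σ (B * b) := by
  rw [Fin.sum_univ_eq_sum_range (fun j : ℕ => σ (B * ((j : ℝ) + 1)) - σ (B * ((j : ℝ) + 1 + 1)))]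
  have h := Finset.sum_range_sub' (fun j : ℕ => σ (B * ((j : ℝ) + 1))) (b - 1)
  push_cast [Nat.cast_sub hb] at h
  rw [h]
  simp

/-- The intervals from `l * b ^ k` to `(l + 1) * b ^ k`, in lexicographic order, tile `[1, ∞)`,
so differences of a function over them telescope. -/
lemma hasSum_digit_telescope (hb : 2 ≤ b) {σ : ℝ → ℝ} {L : ℝ}
    (hσ : ∀ i : ClogDigit b, 0 ≤ σ (i.scale * i.coeff) - σ (i.scale * (i.coeff + 1)))
    (hlim : Tendsto (fun k : ℕ => σ ((b : ℝ) ^ k)) atTop (𝓝 L)) :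
    HasSum (fun i : ClogDigit b => σ (i.scale * i.coeff) - σ (i.scale * (i.coeff + 1)))
      (σ 1 - L) := by
  set F := fun i : ClogDigit b => σ (i.scale * i.coeff) - σ (i.scale * (i.coeff + 1))
  have hin (k : ℕ) : HasSum (fun j => F (k, j)) (σ ((b : ℝ) ^ k) - σ ((b : ℝ) ^ (k + 1))) := by
    rw [pow_succ, ← sum_fin_telescope (by omega) σ]
    exact hasSum_fintype _
  have hnn (k : ℕ) : 0 ≤ σ ((b : ℝ) ^ k) - σ ((b : ℝ) ^ (k + 1)) :=
    (hin k).nonneg fun j => hσ (k, j)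
  have hout : HasSum (fun k : ℕ => σ ((b : ℝ) ^ k) - σ ((b : ℝ) ^ (k + 1))) (σ 1 - L) := by
    rw [hasSum_iff_tendsto_nat_of_nonneg hnn]
    simp_rw [Finset.sum_range_sub' (fun k : ℕ => σ ((b : ℝ) ^ k)), pow_zero]
    exact hlim.const_sub _
  have hs : Summable F := by
    rw [summable_prod_of_nonneg hσ]
    refine ⟨fun k => (hin k).summable, ?_⟩
    exact hout.summable.congr fun k => ((hin k).tsum_eq).symm
  have := hs.hasSum.prod_fiberwise hin
  rw [hout.unique this]
  exact hs.hasSum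

lemma tendsto_natCast_pow_atTop (hb : 2 ≤ b) :
    Tendsto (fun k : ℕ => (b : ℝ) ^ k) atTop atTop :=
  tendsto_pow_atTop_atTop_of_one_lt (by exact_mod_cast (by omega : 1 < b))

lemma hasSum_weight (hb : 2 ≤ b) {t : ℝ} (ht : 0 ≤ t) :
    HasSum (fun i : ClogDigit b => i.weight t) 1 := by
  have h := hasSum_digit_telescope hb (σ := fun m => (1 + t) / (m + t)) (L := 0)
    (fun i => by rw [← i.weight_eq_sub ht]; exact i.weight_nonneg ht)
    ((tendsto_atTop_add_const_right _ t (tendsto_natCast_pow_atTop hb)).const_div_atTop _)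
  have h1 : 1 + t ≠ 0 := by positivity
  simp only [div_self h1, sub_zero] at h
  exact h.congr_fun fun i => i.weight_eq_sub ht

end telescoping

section contraction

variable {b : ℕ}

/-- Up to the factor `t - s`, the left side is the change of the weight of the digit interval
`[m, n)` between the parameters `s` and `t`. The bound, which is the case `s = t = 0`, does not
depend on the parameters and telescopes over the digits. -/
lemma abs_weight_increment_le {m n : ℕ} (hm : 2 ≤ m) (hmn : m < n) {s t : ℝ}
    (hs : s ∈ Set.Icc (0 : ℝ) 1) (ht : t ∈ Set.Icc (0 : ℝ) 1) :
    |((m : ℝ) - 1) / ((m + t) * (m + s)) - (n - 1) / ((n + t) * (n + s))| ≤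
      ((m : ℝ) - 1) / m ^ 2 - (n - 1) / n ^ 2 := by
  obtain ⟨hs0, hs1⟩ := hs
  obtain ⟨ht0, ht1⟩ := ht
  have hm' : (2 : ℝ) ≤ m := by exact_mod_cast hm
  have hmn' : (m : ℝ) + 1 ≤ n := by exact_mod_cast hmn
  have hm0 : (0 : ℝ) < m := by linarith
  have hn0 : (0 : ℝ) < n := by linarith
  set X : ℝ := ((m : ℝ) - 1) * (n - 1) with hX
  set q : ℝ := (1 + s) * (1 + t) with hq
  set P : ℝ := ((m + t) * (m + s)) * ((n + t) * (n + s)) with hP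
  have e1 : ((m : ℝ) - 1) / ((m + t) * (m + s)) - (n - 1) / ((n + t) * (n + s)) =
      (n - m) * ((X - q) / P) := by
    rw [hP, hX, hq]; field_simp; ring
  have e2 : ((m : ℝ) - 1) / m ^ 2 - (n - 1) / n ^ 2 = (n - m) * ((X - 1) / (m ^ 2 * n ^ 2)) := by
    rw [hX]; field_simp; ring
  have hq1 : 1 ≤ q := by rw [hq]; nlinarith
  have hq4 : q ≤ 4 := by rw [hq]; nlinarith
  have hX2 : 2 ≤ X := by rw [hX]; nlinarith
  have hM0 : (0 : ℝ) < m ^ 2 * n ^ 2 := by positivity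
  have hPM : (m : ℝ) ^ 2 * n ^ 2 ≤ P := by
    rw [hP]
    apply mul_le_mul <;> first | positivity | nlinarith
  have hP0 : 0 < P := hM0.trans_le hPM
  rw [e1, e2, abs_mul, abs_of_pos (by linarith : (0 : ℝ) < n - m)]
  refine mul_le_mul_of_nonneg_left (abs_le'.2 ⟨?_, ?_⟩) (by linarith)
  · exact div_le_div₀ (by linarith) (by linarith) hM0 hPM
  · rw [← neg_div]
    -- unless `m = 2` and `n = 3`, even `q - X ≤ X - 1` holds
    by_cases h : m = 2 ∧ n = 3
    · obtain ⟨rfl, rfl⟩ := h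
      rw [div_le_div_iff₀ hP0 hM0, hP, hX, hq]
      push_cast
      have h1 : s * t ≤ (s + t) / 2 := by nlinarith
      have h2 : (9 : ℝ) ≤ (3 + t) * (3 + s) := by nlinarith
      have h3 : (2 + t) * (2 + s) * 9 ≤ (2 + t) * (2 + s) * ((3 + t) * (3 + s)) :=
        mul_le_mul_of_nonneg_left h2 (by positivity)
      nlinarith [mul_nonneg hs0 ht0]
    · have hX' : (5 : ℝ) / 2 ≤ X := by
        rw [hX]
        rcases Nat.lt_or_ge m 3 with h3 | h3
        · have h4 : 4 ≤ n := by omega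
          have h4' : (4 : ℝ) ≤ n := by exact_mod_cast h4
          nlinarith
        · have h3' : (3 : ℝ) ≤ m := by exact_mod_cast h3
          nlinarith
      exact div_le_div₀ (by linarith) (by linarith) hM0 hPM

/-- The function `m ↦ (m - 1) / m ^ 2`, made constant to the left of its maximum at `2`. Its
differences over the digit intervals dominate the variation of the digit probabilities. -/
def weightVariation (m : ℝ) : ℝ := if m ≤ 2 then 1 / 4 else (m - 1) / m ^ 2

lemma weightVariation_of_two_le {m : ℝ} (hm : 2 ≤ m) : weightVariation m = (m - 1) / m ^ 2 := by
  unfold weightVariation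
  split_ifs with h
  · rw [le_antisymm h hm]; norm_num
  · rfl

/-- Except for the term `1`, the digit intervals have integer endpoints `2 ≤ m < n`. -/
lemma ClogDigit.eq_first_or_two_le (hb : 2 ≤ b) (i : ClogDigit b) :
    i = first hb ∨ ∃ m n : ℕ, 2 ≤ m ∧ m < n ∧ i.scale * i.coeff = m ∧
      i.scale * (i.coeff + 1) = n := by
  by_cases h : b ^ i.1 * (i.2 + 1) < 2
  · left
    have h1 : 1 ≤ b ^ i.1 := Nat.one_le_pow _ _ (by omega)
    have h2 : (i.2 : ℕ) = 0 := by nlinarith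
    have h3 : b ^ i.1 < 2 := by rw [h2] at h; omega
    have h4 : i.1 = 0 := by
      by_contra h4
      have := Nat.le_self_pow h4 b
      omega
    ext
    · exact h4
    · simpa [first] using h2
  · right
    have h1 : 1 ≤ b ^ i.1 := Nat.one_le_pow _ _ (by omega)
    refine ⟨b ^ i.1 * (i.2 + 1), b ^ i.1 * (i.2 + 1 + 1), by omega, by nlinarith, ?_, ?_⟩ <;>
    · simp only [scale, coeff]; push_cast; ring

lemma ClogDigit.weight_sub_weight (i : ClogDigit b) {s t : ℝ} (hs : 0 ≤ s) (ht : 0 ≤ t) :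
    i.weight t - i.weight s = (t - s) *
      ((i.scale * i.coeff - 1) / ((i.scale * i.coeff + t) * (i.scale * i.coeff + s)) -
      (i.scale * (i.coeff + 1) - 1) /
        ((i.scale * (i.coeff + 1) + t) * (i.scale * (i.coeff + 1) + s))) := by
  have h1 := i.scale_pos
  have h2 := i.one_le_coeff
  rw [i.weight_eq_sub ht, i.weight_eq_sub hs]
  have h3 : i.scale * i.coeff + t ≠ 0 := by positivity
  have h4 : i.scale * (i.coeff + 1) + t ≠ 0 := by positivity
  have h5 : i.scale * i.coeff + s ≠ 0 := by positivity
  have h6 : i.scale * (i.coeff + 1) + s ≠ 0 := by positivity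
  generalize i.scale * i.coeff = m at *
  generalize i.scale * (i.coeff + 1) = n at *
  field_simp
  ring

lemma ClogDigit.weightVariation_nonneg (hb : 2 ≤ b) (i : ClogDigit b) :
    0 ≤ weightVariation (i.scale * i.coeff) - weightVariation (i.scale * (i.coeff + 1)) := by
  rcases i.eq_first_or_two_le hb with rfl | ⟨m, n, hm, hmn, h1, h2⟩
  · norm_num [first, scale, coeff, weightVariation]
  · have hm' : (2 : ℝ) ≤ m := by exact_mod_cast hm
    have hn' : (2 : ℝ) ≤ n := by exact_mod_cast hm.trans hmn.le
    rw [h1, h2, weightVariation_of_two_le hm', weightVariation_of_two_le hn']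
    exact (abs_nonneg _).trans (abs_weight_increment_le hm hmn (s := 0) (t := 0) (by simp) (by simp))

lemma ClogDigit.abs_weight_sub_weight_le (hb : 2 ≤ b) (i : ClogDigit b) (hi : i ≠ first hb)
    {s t : ℝ} (hs : s ∈ Set.Icc (0 : ℝ) 1) (ht : t ∈ Set.Icc (0 : ℝ) 1) :
    |i.weight t - i.weight s| ≤ |t - s| *
      (weightVariation (i.scale * i.coeff) - weightVariation (i.scale * (i.coeff + 1))) := by
  obtain h | ⟨m, n, hm, hmn, h1, h2⟩ := i.eq_first_or_two_le hb
  · exact absurd h hi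
  · have hm' : (2 : ℝ) ≤ m := by exact_mod_cast hm
    have hn' : (2 : ℝ) ≤ n := by exact_mod_cast hm.trans hmn.le
    rw [i.weight_sub_weight hs.1 ht.1, h1, h2, weightVariation_of_two_le hm',
      weightVariation_of_two_le hn', abs_mul]
    exact mul_le_mul_of_nonneg_left (abs_weight_increment_le hm hmn hs ht) (abs_nonneg _)

lemma hasSum_weightVariation (hb : 2 ≤ b) :
    HasSum (fun i : ClogDigit b =>
      weightVariation (i.scale * i.coeff) - weightVariation (i.scale * (i.coeff + 1))) (1 / 4) := by
  have hlim : Tendsto (fun k : ℕ => weightVariation ((b : ℝ) ^ k)) atTop (𝓝 0) := by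
    have h1 : Tendsto (fun m : ℝ => (m - 1) / m ^ 2) atTop (𝓝 0) := by
      have h2 : Tendsto (fun m : ℝ => m⁻¹ - m⁻¹ * m⁻¹) atTop (𝓝 (0 - 0 * 0)) :=
        tendsto_inv_atTop_zero.sub (tendsto_inv_atTop_zero.mul tendsto_inv_atTop_zero)
      rw [mul_zero, sub_zero] at h2
      refine h2.congr' ?_
      filter_upwards [eventually_gt_atTop 0] with m hm
      field_simp
    have h3 : Tendsto weightVariation atTop (𝓝 0) := by
      refine h1.congr' ?_
      filter_upwards [eventually_ge_atTop 2] with m hm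
      rw [weightVariation_of_two_le hm]
    exact h3.comp (tendsto_natCast_pow_atTop hb)
  have h := hasSum_digit_telescope hb (fun i => i.weightVariation_nonneg hb) hlim
  have h1 : weightVariation 1 - 0 = 1 / 4 := by norm_num [weightVariation]
  rwa [h1] at h

lemma ClogDigit.abs_param_sub_param (i : ClogDigit b) {s t : ℝ} (hs : 0 ≤ s) (ht : 0 ≤ t) :
    |i.param t - i.param s| =
      i.scale / ((i.scale * i.coeff + t) * (i.scale * i.coeff + s)) * |t - s| := by
  have h1 := i.scale_pos
  have h2 := i.one_le_coeff
  have e : i.param t - i.param s =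
      -(i.scale / ((i.scale * i.coeff + t) * (i.scale * i.coeff + s)) * (t - s)) := by
    unfold param; field_simp; ring
  rw [e, abs_neg, abs_mul, abs_of_nonneg (by positivity)]

/-- The mean displacement of the parameter: apart from the first digit every branch
contracts by a factor `1 / 2`, and the first digit has probability at most `1 / 2`. -/
lemma ClogDigit.weight_mul_abs_param_sub_le (hb : 2 ≤ b) (i : ClogDigit b) {s t : ℝ}
    (hs : s ∈ Set.Icc (0 : ℝ) 1) (ht : t ∈ Set.Icc (0 : ℝ) 1) :
    i.weight t * |i.param t - i.param s| ≤
      |t - s| * (i.weight t * (1 / 2) + if i = first hb then 1 / 4 else 0) := by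
  have hw := i.weight_nonneg ht.1
  have hts := abs_nonneg (t - s)
  obtain ⟨hs0, hs1⟩ := hs
  obtain ⟨ht0, ht1⟩ := ht
  rw [i.abs_param_sub_param hs0 ht0]
  set c := i.scale / ((i.scale * i.coeff + t) * (i.scale * i.coeff + s))
  suffices h : i.weight t * c ≤ i.weight t * (1 / 2) + if i = first hb then 1 / 4 else 0 by
    nlinarith [mul_le_mul_of_nonneg_left h hts]
  have h1 := i.scale_pos
  have h2 := i.one_le_coeff
  rcases i.eq_first_or_two_le hb with h | ⟨m, n, hm, hmn, h3, h4⟩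
  · have hc : c ≤ 1 := by
      refine (div_le_one (by positivity)).2 ?_
      have := i.scale_le_lower
      have := i.one_le_lower
      nlinarith
    have hw2 : i.weight t ≤ 1 / 2 := by
      subst h
      simp only [weight, first, scale, coeff]
      norm_num
      rw [div_le_iff₀ (by positivity)]
      nlinarith
    rw [if_pos h]
    nlinarith
  · have hm' : (2 : ℝ) ≤ m := by exact_mod_cast hm
    have hc : c ≤ 1 / 2 := by
      have h5 := i.scale_le_lower
      have : c ≤ 1 / (m + s) := by
        refine (div_le_div_iff₀ (by positivity) (by positivity)).2 ?_
        rw [h3] at h5 ⊢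
        nlinarith
      exact this.trans (one_div_le_one_div_of_le (by norm_num) (by linarith))
    have : (0 : ℝ) ≤ if i = first hb then 1 / 4 else 0 := by split_ifs <;> norm_num
    nlinarith

/-- Averaging over the first digit contracts Lipschitz constants by the factor `1 - 1 / (4 b)`. -/
lemma abs_sub_le_of_hasSum_weight (hb : 2 ≤ b) {a : ℝ → ℝ} {Λ : ℝ}
    (ha : ∀ s ∈ Set.Icc (0 : ℝ) 1, ∀ t ∈ Set.Icc (0 : ℝ) 1, |a t - a s| ≤ Λ * |t - s|)
    {s t : ℝ} (hs : s ∈ Set.Icc (0 : ℝ) 1) (ht : t ∈ Set.Icc (0 : ℝ) 1) {S T : ℝ}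
    (hS : HasSum (fun i : ClogDigit b => i.weight s * a (i.param s)) S)
    (hT : HasSum (fun i : ClogDigit b => i.weight t * a (i.param t)) T) :
    |T - S| ≤ (1 - 1 / (4 * b)) * Λ * |t - s| := by
  have hΛ : 0 ≤ Λ := by
    have := (abs_nonneg _).trans (ha 0 (by simp) 1 (by simp))
    simpa using this
  have hb0 : (0 : ℝ) < b := by exact_mod_cast (by omega : 0 < b)
  set V := fun i : ClogDigit b =>
    weightVariation (i.scale * i.coeff) - weightVariation (i.scale * (i.coeff + 1))
  -- the weights have constant sum, so a constant can be subtracted from `a` in their variation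
  have h1 := ((hT.sub hS).sub
    (((hasSum_weight hb ht.1).sub (hasSum_weight hb hs.1)).mul_right (a ((first hb).param s))))
  rw [sub_self, zero_mul, sub_zero] at h1
  have h2 : HasSum (fun i : ClogDigit b => Λ * |t - s| *
      ((i.weight t * (1 / 2) + if i = first hb then 1 / 4 else 0) + V i * (1 - (b : ℝ)⁻¹)))
      (Λ * |t - s| * ((1 * (1 / 2) + 1 / 4) + 1 / 4 * (1 - (b : ℝ)⁻¹))) :=
    ((((hasSum_weight hb ht.1).mul_right _).add (hasSum_ite_eq _ _)).add
      ((hasSum_weightVariation hb).mul_right _)).mul_left _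
  have h3 : (1 - 1 / (4 * b)) * Λ * |t - s| =
      Λ * |t - s| * ((1 * (1 / 2) + 1 / 4) + 1 / 4 * (1 - (b : ℝ)⁻¹)) := by
    field_simp; ring
  rw [h3, ← Real.norm_eq_abs]
  refine h1.norm_le_of_bounded h2 fun i => ?_
  rw [Real.norm_eq_abs]
  have e : i.weight t * a (i.param t) - i.weight s * a (i.param s) -
      (i.weight t - i.weight s) * a ((first hb).param s) =
      i.weight t * (a (i.param t) - a (i.param s)) +
      (i.weight t - i.weight s) * (a (i.param s) - a ((first hb).param s)) := by ring
  rw [e, mul_add]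
  refine (abs_add_le _ _).trans (add_le_add ?_ ?_)
  · rw [abs_mul, abs_of_nonneg (i.weight_nonneg ht.1)]
    calc i.weight t * |a (i.param t) - a (i.param s)|
        ≤ i.weight t * (Λ * |i.param t - i.param s|) :=
          mul_le_mul_of_nonneg_left (ha _ (i.param_mem hs) _ (i.param_mem ht))
            (i.weight_nonneg ht.1)
      _ = Λ * (i.weight t * |i.param t - i.param s|) := by ring
      _ ≤ _ := by
        rw [mul_assoc]
        exact mul_le_mul_of_nonneg_left (i.weight_mul_abs_param_sub_le hb hs ht) hΛ
  · have hV : 0 ≤ V i := i.weightVariation_nonneg hb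
    have hb1 : (0 : ℝ) ≤ 1 - (b : ℝ)⁻¹ := by
      rw [sub_nonneg]; exact inv_le_one_of_one_le₀ (by exact_mod_cast (by omega : 1 ≤ b))
    by_cases hi : i = first hb
    · rw [hi, sub_self, mul_zero, abs_zero]
      rw [hi] at hV
      positivity
    · rw [abs_mul]
      have h4 : |i.param s - (first hb).param s| ≤ 1 - (b : ℝ)⁻¹ := by
        have := i.inv_le_param hs
        have := i.param_le_one hs.1
        have := (first hb).inv_le_param hs
        have := (first hb).param_le_one hs.1
        exact abs_le.2 ⟨by linarith, by linarith⟩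
      calc |i.weight t - i.weight s| * |a (i.param s) - a ((first hb).param s)|
          ≤ (|t - s| * V i) * (Λ * (1 - (b : ℝ)⁻¹)) :=
            mul_le_mul (i.abs_weight_sub_weight_le hb hi hs ht)
              ((ha _ ((first hb).param_mem hs) _ (i.param_mem hs)).trans
                (mul_le_mul_of_nonneg_left h4 hΛ)) (abs_nonneg _) (by positivity)
        _ = _ := by ring

end contraction

/-! ### The invariant measure -/

section invariantMeasure

variable {b : ℕ}

/-- The density of the invariant measure of the continued logarithm map, before normalization. -/
def clogDensity (b : ℕ) (x : ℝ) : ℝ := 1 / (1 + x) - 1 / (b + x)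

/-- The invariant measure of the continued logarithm map on the unit interval. It is not
normalized: its total mass is `log (2 b / (b + 1))`. -/
def clogMeasure (b : ℕ) : Measure ℝ :=
  (volume.restrict (Set.Ioo 0 1)).withDensity fun x => ENNReal.ofReal (clogDensity b x)

lemma measurable_clogExponent : Measurable (clogExponent b) :=
  Nat.measurable_floor.comp (Real.measurable_log.div_const _)

lemma measurable_clogCoeff : Measurable (clogCoeff b) := by
  refine Nat.measurable_floor.comp (measurable_id.div ?_)
  exact (measurable_from_nat (f := fun k : ℕ => (b : ℝ) ^ k)).comp measurable_clogExponent

lemma measurable_clogMap : Measurable (clogMap b) := by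
  refine (measurable_inv.div ?_).sub ?_
  · exact (measurable_from_nat (f := fun k : ℕ => (b : ℝ) ^ k)).comp
      (measurable_clogExponent.comp measurable_inv)
  · exact (measurable_from_nat (f := fun k : ℕ => (k : ℝ))).comp
      (measurable_clogCoeff.comp measurable_inv)

lemma measurable_clogDensity : Measurable (clogDensity b) := by
  unfold clogDensity; fun_prop

lemma clogDensity_le_one {x : ℝ} (hx : x ∈ Set.Ioo (0 : ℝ) 1) : clogDensity b x ≤ 1 := by
  have h1 : 1 / (1 + x) ≤ 1 := (div_le_one (by linarith [hx.1])).2 (by linarith [hx.1])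
  have h2 : 0 ≤ 1 / ((b : ℝ) + x) := by have := hx.1; positivity
  unfold clogDensity; linarith

lemma le_clogDensity (hb : 2 ≤ b) {x : ℝ} (hx : x ∈ Set.Ioo (0 : ℝ) 1) :
    1 / 6 ≤ clogDensity b x := by
  have hb' : (2 : ℝ) ≤ b := by exact_mod_cast hb
  obtain ⟨h0, h1⟩ := hx
  have h2 : 1 / ((b : ℝ) + x) ≤ 1 / (2 + x) :=
    one_div_le_one_div_of_le (by linarith) (by linarith)
  have h3 : 1 / (1 + x) - 1 / (2 + x) = 1 / ((1 + x) * (2 + x)) := by field_simp; ring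
  have h4 : 1 / 6 ≤ 1 / ((1 + x) * (2 + x)) :=
    one_div_le_one_div_of_le (by positivity) (by nlinarith)
  unfold clogDensity; linarith

/-- The invariant density is a fixed point of the transfer operator: over the branches with a
given coefficient the sum telescopes in the exponent, and the results telescope in the
coefficient. -/
lemma hasSum_jacobian_mul_clogDensity (hb : 2 ≤ b) {x : ℝ} (hx : 0 < x) :
    HasSum (fun i : ClogDigit b =>
      (i.scale * (i.coeff + x) ^ 2)⁻¹ * clogDensity b (i.branch x)) (clogDensity b x) := by
  have hb' : (2 : ℝ) ≤ b := by exact_mod_cast hb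
  have key (k : ℕ) (j : Fin (b - 1)) :
      (scale (k, j) * (coeff (k, j) + x) ^ 2)⁻¹ * clogDensity b (branch (k, j) x) =
        1 / (((j : ℕ) + 1) + x + ((b : ℝ) ^ (k + 1))⁻¹) -
          1 / (((j : ℕ) + 1) + x + ((b : ℝ) ^ k)⁻¹) := by
    simp only [scale, coeff, branch, clogDensity, pow_succ]
    have hy : 0 < ((j : ℕ) : ℝ) + 1 + x := by positivity
    have hB : 0 < (b : ℝ) ^ k := by positivity
    generalize ((j : ℕ) : ℝ) + 1 + x = y at *
    generalize (b : ℝ) ^ k = B at *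
    have hb0 : (0 : ℝ) < b := by linarith
    have h1 : 1 + (B * y)⁻¹ = (B * y + 1) / (B * y) := by field_simp
    have h2 : (b : ℝ) + (B * y)⁻¹ = (b * B * y + 1) / (B * y) := by field_simp
    have h3 : y + (B * b)⁻¹ = (b * B * y + 1) / (b * B) := by field_simp
    have h4 : y + B⁻¹ = (B * y + 1) / B := by field_simp
    rw [h1, h2, h3, h4]
    field_simp
    ring
  have hin (j : Fin (b - 1)) : HasSum (fun k : ℕ =>
      1 / (((j : ℕ) + 1) + x + ((b : ℝ) ^ (k + 1))⁻¹) -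
          1 / (((j : ℕ) + 1) + x + ((b : ℝ) ^ k)⁻¹))
      (1 / ((1 + x) + (j : ℕ)) - 1 / ((1 + x) + ((j : ℕ) + 1 : ℕ))) := by
    rw [hasSum_iff_tendsto_nat_of_nonneg]
    · simp_rw [Finset.sum_range_sub (fun k : ℕ => 1 / ((((j : ℕ) : ℝ) + 1) + x + ((b : ℝ) ^ k)⁻¹))]
      have h1 : Tendsto (fun k : ℕ => 1 / ((((j : ℕ) : ℝ) + 1) + x + ((b : ℝ) ^ k)⁻¹)) atTop
          (𝓝 (1 / ((((j : ℕ) : ℝ) + 1) + x + 0))) :=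
        tendsto_const_nhds.div (tendsto_const_nhds.add
          (tendsto_inv_atTop_zero.comp (tendsto_natCast_pow_atTop hb))) (by positivity)
      convert h1.sub_const _ using 2
      push_cast
      rw [pow_zero, inv_one]
      congr 2 <;> ring
    · intro k
      rw [sub_nonneg]
      refine one_div_le_one_div_of_le (by positivity) ?_
      gcongr
      · linarith
      · omega
  have hs : HasSum (fun i : Fin (b - 1) × ℕ =>
      (scale (i.2, i.1) * (coeff (i.2, i.1) + x) ^ 2)⁻¹ * clogDensity b (branch (i.2, i.1) x))
      (clogDensity b x) := by
    set F := fun i : Fin (b - 1) × ℕ =>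
      (scale (i.2, i.1) * (coeff (i.2, i.1) + x) ^ 2)⁻¹ * clogDensity b (branch (i.2, i.1) x)
    have hF (j : Fin (b - 1)) : HasSum (fun k => F (j, k))
        (1 / ((1 + x) + (j : ℕ)) - 1 / ((1 + x) + ((j : ℕ) + 1 : ℕ))) :=
      (hin j).congr_fun fun k => key k j
    have hF0 (i) : 0 ≤ F i := by
      simp only [F, key, sub_nonneg]
      refine one_div_le_one_div_of_le (by positivity) ?_
      gcongr
      · linarith
      · omega
    have hs : Summable F :=
      (summable_prod_of_nonneg hF0).2 ⟨fun j => (hF j).summable, (hasSum_fintype _).summable⟩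
    have h1 := hs.hasSum.prod_fiberwise hF
    have h2 := hasSum_fintype fun j : Fin (b - 1) =>
      1 / ((1 + x) + (j : ℕ)) - 1 / ((1 + x) + ((j : ℕ) + 1 : ℕ))
    rw [Fin.sum_univ_eq_sum_range
      (fun j : ℕ => 1 / ((1 + x) + j) - 1 / ((1 + x) + ((j + 1 : ℕ) : ℝ))),
      Finset.sum_range_sub' (fun j : ℕ => 1 / ((1 + x) + j))] at h2
    have h3 : clogDensity b x =
        1 / ((1 + x) + (0 : ℕ)) - 1 / ((1 + x) + (b - 1 : ℕ)) := by
      rw [clogDensity, Nat.cast_sub (by omega : 1 ≤ b)]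
      push_cast
      congr 2 <;> ring
    rw [h3, h2.unique h1]
    exact hs.hasSum
  exact (Equiv.prodComm (Fin (b - 1)) ℕ).hasSum_iff.1 hs

lemma lintegral_clogMeasure {v : ℝ → ENNReal} (hv : Measurable v) :
    ∫⁻ x, v x ∂clogMeasure b = ∫⁻ x in Set.Ioo 0 1, ENNReal.ofReal (clogDensity b x) * v x := by
  rw [clogMeasure, lintegral_withDensity_eq_lintegral_mul _
    (measurable_clogDensity.ennreal_ofReal) hv]
  rfl

lemma measurePreserving_clogMap (hb : 2 ≤ b) :
    MeasurePreserving (clogMap b) (clogMeasure b) (clogMeasure b) := by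
  refine ⟨measurable_clogMap, Measure.ext_of_lintegral _ fun v hv => ?_⟩
  have h0 := lintegral_clogMeasure (b := b) (hv.comp (measurable_clogMap (b := b)))
  simp only [Function.comp_apply] at h0
  rw [lintegral_map hv measurable_clogMap, lintegral_clogMeasure hv, h0,
    lintegral_eq_tsum_branch hb]
  have hbr (i : ClogDigit b) : Measurable i.branch := by unfold branch; fun_prop
  have e (i : ClogDigit b) : ∫⁻ x in Set.Ioo 0 1,
      ENNReal.ofReal (i.scale * (i.coeff + x) ^ 2)⁻¹ *
        (ENNReal.ofReal (clogDensity b (i.branch x)) * v (clogMap b (i.branch x))) =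
      ∫⁻ x in Set.Ioo 0 1, ENNReal.ofReal
        ((i.scale * (i.coeff + x) ^ 2)⁻¹ * clogDensity b (i.branch x)) * v x := by
    refine setLIntegral_congr_fun measurableSet_Ioo fun x hx => ?_
    have := i.scale_pos
    rw [clogMap_branch i ⟨hx.1.le, hx.2⟩, ← mul_assoc, ← ENNReal.ofReal_mul (by positivity)]
  rw [tsum_congr e, ← lintegral_tsum]
  · refine setLIntegral_congr_fun measurableSet_Ioo fun x hx => ?_
    have h := hasSum_jacobian_mul_clogDensity hb hx.1
    rw [ENNReal.tsum_mul_right, ← ENNReal.ofReal_tsum_of_nonneg _ h.summable, h.tsum_eq]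
    intro i
    have := i.scale_pos
    have := le_clogDensity hb (branch_mem_Ioo i hx)
    exact mul_nonneg (by positivity) (by linarith)
  · intro i
    have := (measurable_clogDensity (b := b)).comp (hbr i)
    have h2 : Measurable fun x : ℝ => (i.scale * (i.coeff + x) ^ 2)⁻¹ := by fun_prop
    exact ((h2.mul this).ennreal_ofReal.mul hv).aemeasurable

lemma clogMeasure_le : clogMeasure b ≤ volume.restrict (Set.Ioo 0 1) := by
  refine Measure.le_intro fun s hs _ => ?_
  rw [clogMeasure, withDensity_apply _ hs, ← setLIntegral_one]
  refine lintegral_mono_ae ?_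
  filter_upwards [ae_restrict_of_ae (ae_restrict_mem measurableSet_Ioo)] with x hx
  exact ENNReal.ofReal_le_one.2 (clogDensity_le_one hx)

lemma restrict_Ioo_le_clogMeasure (hb : 2 ≤ b) :
    volume.restrict (Set.Ioo 0 1) ≤ (6 : ENNReal) • clogMeasure b := by
  refine Measure.le_intro fun s hs _ => ?_
  rw [Measure.smul_apply, clogMeasure, withDensity_apply _ hs, ← setLIntegral_one, smul_eq_mul,
    ← lintegral_const_mul _ measurable_clogDensity.ennreal_ofReal]
  refine lintegral_mono_ae ?_
  filter_upwards [ae_restrict_of_ae (ae_restrict_mem measurableSet_Ioo)] with x hx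
  have h : ENNReal.ofReal (1 / 6) ≤ ENNReal.ofReal (clogDensity b x) :=
    ENNReal.ofReal_le_ofReal (le_clogDensity hb hx)
  calc (1 : ENNReal) = 6 * ENNReal.ofReal (1 / 6) := by
        rw [show (6 : ENNReal) = ENNReal.ofReal 6 by simp, ← ENNReal.ofReal_mul (by norm_num)]
        norm_num
    _ ≤ _ := by gcongr

instance : IsFiniteMeasure (clogMeasure b) :=
  isFiniteMeasure_of_le _ clogMeasure_le

lemma memLp_comp_iterate_clogMap (hb : 2 ≤ b) {p : ENNReal} {v : ℝ → ℝ}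
    (hv : MemLp v p (volume.restrict (Set.Ioo 0 1))) (n : ℕ) :
    MemLp (v ∘ (clogMap b)^[n]) p (volume.restrict (Set.Ioo 0 1)) :=
  ((hv.mono_measure clogMeasure_le).comp_measurePreserving
    ((measurePreserving_clogMap hb).iterate n)).of_measure_le_smul (by simp)
      (restrict_Ioo_le_clogMeasure hb)

lemma integral_comp_iterate_clogMap (hb : 2 ≤ b) {v : ℝ → ℝ}
    (hv : AEStronglyMeasurable v (clogMeasure b)) (n : ℕ) :
    ∫ x, (v ∘ (clogMap b)^[n]) x ∂clogMeasure b = ∫ x, v x ∂clogMeasure b := by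
  have h := (measurePreserving_clogMap hb).iterate n
  rw [← h.map_eq] at hv
  conv_rhs => rw [← h.map_eq, integral_map h.measurable.aemeasurable hv]
  rfl

lemma integral_comp_iterate_clogMap_le (hb : 2 ≤ b) {v : ℝ → ℝ} (h0 : ∀ x, 0 ≤ v x)
    (hv : IntegrableOn v (Set.Ioo 0 1)) (n : ℕ) :
    ∫ x in Set.Ioo 0 1, (v ∘ (clogMap b)^[n]) x ≤ 6 * ∫ x in Set.Ioo 0 1, v x := by
  have hvμ : Integrable v (clogMeasure b) :=
    Integrable.mono_measure hv clogMeasure_le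
  have h1 : Integrable (v ∘ (clogMap b)^[n]) (clogMeasure b) := by
    rw [← memLp_one_iff_integrable] at hvμ ⊢
    exact hvμ.comp_measurePreserving ((measurePreserving_clogMap hb).iterate n)
  calc ∫ x in Set.Ioo 0 1, (v ∘ (clogMap b)^[n]) x
      ≤ ∫ x, (v ∘ (clogMap b)^[n]) x ∂((6 : ENNReal) • clogMeasure b) :=
        integral_mono_measure (restrict_Ioo_le_clogMeasure hb)
          (ae_of_all _ fun x => h0 _) (h1.smul_measure (by simp))
    _ = 6 * ∫ x, v x ∂clogMeasure b := by
        rw [integral_smul_measure, integral_comp_iterate_clogMap hb hvμ.1]; simp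
    _ ≤ _ := mul_le_mul_of_nonneg_left
        (integral_mono_measure clogMeasure_le (ae_of_all _ h0) hv) (by norm_num)

lemma ae_iterate_clogMap_mem_Ioo (hb : 2 ≤ b) :
    ∀ᵐ x ∂volume.restrict (Set.Ioo (0 : ℝ) 1), ∀ n, (clogMap b)^[n] x ∈ Set.Ioo (0 : ℝ) 1 := by
  rw [ae_all_iff]
  intro n
  have h1 : ∀ᵐ x ∂clogMeasure b, x ∈ Set.Ioo (0 : ℝ) 1 :=
    ae_mono clogMeasure_le (ae_restrict_mem measurableSet_Ioo)
  exact ((Measure.absolutelyContinuous_of_le (restrict_Ioo_le_clogMeasure hb)).trans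
    Measure.smul_absolutelyContinuous).ae_le
      (((measurePreserving_clogMap hb).iterate n).quasiMeasurePreserving.ae h1)

end invariantMeasure

/-! ### Exponential mixing -/

section kernel

variable {b : ℕ}

/-- The expectation of `w` under the density `clogKernel t` on the unit interval. -/
def clogExpect (t : ℝ) (w : ℝ → ℝ) : ℝ := ∫ x in Set.Ioo 0 1, clogKernel t x * w x

lemma clogExpect_zero (w : ℝ → ℝ) : clogExpect 0 w = ∫ x in Set.Ioo 0 1, w x := by
  simp [clogExpect, clogKernel]

lemma clogKernel_nonneg {t : ℝ} (ht : 0 ≤ t) (x : ℝ) : 0 ≤ clogKernel t x := by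
  unfold clogKernel; positivity

lemma clogKernel_le_two {t x : ℝ} (ht : t ∈ Set.Icc (0 : ℝ) 1) (hx : 0 ≤ x) :
    clogKernel t x ≤ 2 := by
  have h := mul_nonneg ht.1 hx
  rw [clogKernel, div_le_iff₀ (by positivity)]
  nlinarith [ht.2]

lemma measurable_clogKernel (t : ℝ) : Measurable (clogKernel t) := by
  unfold clogKernel; fun_prop

lemma clogExpect_one {t : ℝ} (ht : 0 ≤ t) : clogExpect t (fun _ => 1) = 1 := by
  have hpos : ∀ x ∈ Set.uIcc (0 : ℝ) 1, 0 ≤ x := by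
    intro x hx
    rw [Set.uIcc_of_le zero_le_one] at hx
    exact hx.1
  have hd : ∀ x ∈ Set.uIcc (0 : ℝ) 1,
      HasDerivAt (fun x => (1 + t) * x / (1 + t * x)) (clogKernel t x * 1) x := by
    intro x hx
    have hx0 := hpos x hx
    have h1 : 1 + t * x ≠ 0 := by positivity
    have h2 : HasDerivAt (fun x : ℝ => 1 + t * x) (t * 1) x :=
      ((hasDerivAt_id x).const_mul t).const_add 1
    refine (((hasDerivAt_id x).const_mul (1 + t)).div h2 h1).congr_deriv ?_
    unfold clogKernel
    simp only [id]
    field_simp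
    ring
  rw [clogExpect, ← integral_Ioc_eq_integral_Ioo, ← intervalIntegral.integral_of_le zero_le_one,
    intervalIntegral.integral_eq_sub_of_hasDerivAt hd]
  · have : 1 + t ≠ 0 := by positivity
    simp [this]
  · refine ContinuousOn.intervalIntegrable fun x hx => ContinuousAt.continuousWithinAt ?_
    have hx0 := hpos x hx
    have h1 : (1 + t * x) ^ 2 ≠ 0 := by positivity
    unfold clogKernel
    fun_prop (disch := assumption)

lemma abs_clogKernel_sub_le {s t x : ℝ} (hs : s ∈ Set.Icc (0 : ℝ) 1)
    (ht : t ∈ Set.Icc (0 : ℝ) 1) (hx : x ∈ Set.Ioo (0 : ℝ) 1) :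
    |clogKernel t x - clogKernel s x| ≤ 4 * |t - s| := by
  obtain ⟨hs0, hs1⟩ := hs
  obtain ⟨ht0, ht1⟩ := ht
  obtain ⟨hx0, hx1⟩ := hx
  have e : clogKernel t x - clogKernel s x =
      (1 - 2 * x - x ^ 2 * (s + t) - s * t * x ^ 2) / ((1 + t * x) ^ 2 * (1 + s * x) ^ 2) *
        (t - s) := by
    unfold clogKernel; field_simp; ring
  have h1 : 1 ≤ (1 + t * x) ^ 2 := one_le_pow₀ (by nlinarith)
  have h2 : 1 ≤ (1 + s * x) ^ 2 := one_le_pow₀ (by nlinarith)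
  have h3 : x ^ 2 ≤ 1 := by nlinarith
  have h4 : s * t ≤ 1 := by nlinarith
  have h5 : 0 ≤ s * t := mul_nonneg hs0 ht0
  have h6 : 0 ≤ x ^ 2 := sq_nonneg x
  have h7 : |1 - 2 * x - x ^ 2 * (s + t) - s * t * x ^ 2| ≤ 4 := by
    rw [abs_le]; constructor <;> nlinarith
  rw [e, abs_mul, abs_div, abs_of_nonneg (by positivity : 0 ≤ (1 + t * x) ^ 2 * (1 + s * x) ^ 2)]
  refine mul_le_mul_of_nonneg_right ?_ (abs_nonneg _)
  exact (div_le_self (abs_nonneg _) (one_le_mul_of_one_le_of_one_le h1 h2)).trans h7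

lemma integrableOn_clogKernel_mul {t : ℝ} (ht : t ∈ Set.Icc (0 : ℝ) 1) {w : ℝ → ℝ}
    (hw : IntegrableOn w (Set.Ioo 0 1)) :
    IntegrableOn (fun x => clogKernel t x * w x) (Set.Ioo 0 1) := by
  refine Integrable.bdd_mul (c := 2) hw (measurable_clogKernel t).aestronglyMeasurable ?_
  filter_upwards [ae_restrict_mem measurableSet_Ioo] with x hx
  rw [Real.norm_eq_abs, abs_of_nonneg (clogKernel_nonneg ht.1 x)]
  exact clogKernel_le_two ht hx.1.le

lemma clogExpect_abs_le {t : ℝ} (ht : t ∈ Set.Icc (0 : ℝ) 1) {w : ℝ → ℝ}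
    (hw : IntegrableOn w (Set.Ioo 0 1)) :
    clogExpect t (fun x => |w x|) ≤ 2 * ∫ x in Set.Ioo 0 1, |w x| := by
  rw [clogExpect, ← integral_const_mul]
  refine setIntegral_mono_on (integrableOn_clogKernel_mul ht hw.abs) (hw.abs.const_mul 2)
    measurableSet_Ioo fun x hx => ?_
  exact mul_le_mul_of_nonneg_right (clogKernel_le_two ht hx.1.le) (abs_nonneg _)

lemma abs_clogExpect_sub_le {s t : ℝ} (hs : s ∈ Set.Icc (0 : ℝ) 1)
    (ht : t ∈ Set.Icc (0 : ℝ) 1) {w : ℝ → ℝ} (hw : IntegrableOn w (Set.Ioo 0 1)) :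
    |clogExpect t w - clogExpect s w| ≤ (4 * ∫ x in Set.Ioo 0 1, |w x|) * |t - s| := by
  rw [clogExpect, clogExpect, ← integral_sub (integrableOn_clogKernel_mul ht hw)
    (integrableOn_clogKernel_mul hs hw), mul_right_comm, ← integral_const_mul,
    ← Real.norm_eq_abs]
  refine norm_integral_le_of_norm_le (hw.abs.const_mul _) ?_
  filter_upwards [ae_restrict_mem measurableSet_Ioo] with x hx
  rw [← sub_mul, Real.norm_eq_abs, abs_mul]
  exact mul_le_mul_of_nonneg_right (abs_clogKernel_sub_le hs ht hx) (abs_nonneg _)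

/-- The Markov property: under `clogKernel t` the first digit is `i` with probability
`i.weight t`, and then the image point has density `clogKernel (i.param t)`. -/
lemma hasSum_clogExpect (hb : 2 ≤ b) {t : ℝ} (ht : t ∈ Set.Icc (0 : ℝ) 1) {u w : ℝ → ℝ}
    {g : ClogDigit b → ℝ} (hu : ∀ i, ∀ x ∈ Set.Ioo (0 : ℝ) 1, u (i.branch x) = g i)
    (h : IntegrableOn (fun x => u x * w (clogMap b x)) (Set.Ioo 0 1)) :
    HasSum (fun i => i.weight t * g i * clogExpect (i.param t) w)
      (clogExpect t fun x => u x * w (clogMap b x)) := by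
  refine (hasSum_integral_branch hb (integrableOn_clogKernel_mul ht h)).congr_fun fun i => ?_
  rw [clogExpect, ← integral_const_mul]
  refine setIntegral_congr_fun measurableSet_Ioo fun x hx => ?_
  rw [clogMap_branch i ⟨hx.1.le, hx.2⟩, hu i x hx]
  linear_combination (-(g i * w x)) * i.jacobian_mul_clogKernel ht.1 hx.1.le

lemma hasSum_clogExpect_comp (hb : 2 ≤ b) {t : ℝ} (ht : t ∈ Set.Icc (0 : ℝ) 1) {w : ℝ → ℝ}
    (h : IntegrableOn (w ∘ clogMap b) (Set.Ioo 0 1)) :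
    HasSum (fun i : ClogDigit b => i.weight t * clogExpect (i.param t) w)
      (clogExpect t (w ∘ clogMap b)) := by
  have := hasSum_clogExpect hb ht (u := fun _ => 1) (g := fun _ => 1) (w := w)
    (fun _ _ _ => rfl) (by simpa [Function.comp_def] using h)
  simpa [Function.comp_def] using this

end kernel

section decay

variable {b : ℕ}

lemma integral_clogMeasure (hb : 2 ≤ b) (v : ℝ → ℝ) :
    ∫ x, v x ∂clogMeasure b = ∫ x in Set.Ioo 0 1, clogDensity b x * v x := by
  rw [clogMeasure, integral_withDensity_eq_integral_toReal_smul
    measurable_clogDensity.ennreal_ofReal (by simp)]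
  refine setIntegral_congr_fun measurableSet_Ioo fun x hx => ?_
  have h : 0 ≤ clogDensity b x := by
    have := le_clogDensity hb hx
    linarith
  simp only [smul_eq_mul]
  rw [ENNReal.toReal_ofReal h]

/-- The invariant density is a mixture of the densities `clogKernel s`, with `s` distributed on
`[1 / b, 1]` according to a multiple of `ds / (1 + s)`. -/
lemma integral_clogKernel_eq_clogDensity (hb : 2 ≤ b) {x : ℝ} (hx : 0 < x) :
    ∫ s in Set.Ioc (b : ℝ)⁻¹ 1, (1 + s)⁻¹ * clogKernel s x = clogDensity b x := by
  have hb' : (2 : ℝ) ≤ b := by exact_mod_cast hb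
  have hb1 : (b : ℝ)⁻¹ ≤ 1 := inv_le_one_of_one_le₀ (by linarith)
  have hpos : ∀ s ∈ Set.uIcc (b : ℝ)⁻¹ 1, 0 < s := by
    intro s hs
    rw [Set.uIcc_of_le hb1] at hs
    exact lt_of_lt_of_le (by positivity) hs.1
  have hd : ∀ s ∈ Set.uIcc (b : ℝ)⁻¹ 1,
      HasDerivAt (fun s => s / (1 + s * x)) ((1 + s)⁻¹ * clogKernel s x) s := by
    intro s hs
    have hs0 := hpos s hs
    have h1 : 1 + s * x ≠ 0 := by positivity
    have h2 : HasDerivAt (fun s : ℝ => 1 + s * x) (1 * x) s :=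
      ((hasDerivAt_id s).mul_const x).const_add 1
    refine ((hasDerivAt_id s).div h2 h1).congr_deriv ?_
    unfold clogKernel
    simp only [id]
    field_simp
    ring
  rw [← intervalIntegral.integral_of_le hb1,
    intervalIntegral.integral_eq_sub_of_hasDerivAt hd]
  · unfold clogDensity
    field_simp
  · refine ContinuousOn.intervalIntegrable fun s hs => ContinuousAt.continuousWithinAt ?_
    have hs0 := hpos s hs
    have h1 : (1 + s * x) ^ 2 ≠ 0 := by positivity
    have h2 : 1 + s ≠ 0 := by positivity
    unfold clogKernel
    fun_prop (disch := assumption)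

lemma integral_inv_mul_clogExpect (hb : 2 ≤ b) {w : ℝ → ℝ} (hw : IntegrableOn w (Set.Ioo 0 1)) :
    IntegrableOn (fun s => (1 + s)⁻¹ * clogExpect s w) (Set.Ioc (b : ℝ)⁻¹ 1) ∧
    ∫ s in Set.Ioc (b : ℝ)⁻¹ 1, (1 + s)⁻¹ * clogExpect s w = ∫ x, w x ∂clogMeasure b := by
  have hprod : Integrable (fun z : ℝ × ℝ => ((1 + z.1)⁻¹ * clogKernel z.1 z.2) * w z.2)
      ((volume.restrict (Set.Ioc (b : ℝ)⁻¹ 1)).prod (volume.restrict (Set.Ioo 0 1))) := by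
    refine Integrable.bdd_mul (c := 2) (hw.comp_snd _)
      (Measurable.aestronglyMeasurable (by unfold clogKernel; fun_prop)) ?_
    rw [Measure.prod_restrict]
    filter_upwards [ae_restrict_mem (measurableSet_Ioc.prod measurableSet_Ioo)] with z hz
    obtain ⟨⟨h1, h2⟩, h3, h4⟩ := hz
    have h0 : 0 ≤ z.1 := (inv_nonneg.2 (Nat.cast_nonneg b)).trans h1.le
    have h5 : (1 + z.1)⁻¹ ≤ 1 := inv_le_one_of_one_le₀ (by linarith)
    have h6 : 0 ≤ (1 + z.1)⁻¹ := by positivity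
    rw [Real.norm_eq_abs, abs_of_nonneg (mul_nonneg h6 (clogKernel_nonneg h0 _))]
    nlinarith [clogKernel_le_two ⟨h0, h2⟩ h3.le, clogKernel_nonneg h0 z.2]
  have e (s : ℝ) : (1 + s)⁻¹ * clogExpect s w =
      ∫ x in Set.Ioo 0 1, ((1 + s)⁻¹ * clogKernel s x) * w x := by
    rw [clogExpect, ← integral_const_mul]
    simp_rw [mul_assoc]
  simp_rw [e]
  refine ⟨hprod.integral_prod_left, ?_⟩
  rw [integral_integral_swap hprod, integral_clogMeasure hb]
  refine setIntegral_congr_fun measurableSet_Ioo fun x hx => ?_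
  rw [integral_mul_const, integral_clogKernel_eq_clogDensity hb hx.1]

/-- The invariant measure is a mixture of the densities `clogKernel t`, so expectations that vary
by at most `η` with `t` are within `η` of the mean under the invariant measure. -/
lemma abs_clogExpect_le_of_integral_eq_zero (hb : 2 ≤ b) {w : ℝ → ℝ}
    (hw : IntegrableOn w (Set.Ioo 0 1)) (h0 : ∫ x, w x ∂clogMeasure b = 0) {η : ℝ}
    (hη : ∀ s ∈ Set.Icc (0 : ℝ) 1, ∀ t ∈ Set.Icc (0 : ℝ) 1,
      |clogExpect t w - clogExpect s w| ≤ η) {t : ℝ} (ht : t ∈ Set.Icc (0 : ℝ) 1) :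
    |clogExpect t w| ≤ η := by
  obtain ⟨h1, h2⟩ := integral_inv_mul_clogExpect hb hw
  rw [h0] at h2
  have hb' : (2 : ℝ) ≤ b := by exact_mod_cast hb
  have hb1 : (b : ℝ)⁻¹ < 1 := inv_lt_one_of_one_lt₀ (by linarith)
  have hbpos : (0 : ℝ) < (b : ℝ)⁻¹ := by positivity
  have hint : IntegrableOn (fun s : ℝ => (1 + s)⁻¹) (Set.Ioc (b : ℝ)⁻¹ 1) := by
    refine (ContinuousOn.integrableOn_Icc fun s hs => ?_).mono_set Set.Ioc_subset_Icc_self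
    have : 1 + s ≠ 0 := by linarith [hs.1]
    exact ContinuousAt.continuousWithinAt (by fun_prop (disch := assumption))
  have hW : 0 < ∫ s in Set.Ioc (b : ℝ)⁻¹ 1, (1 + s)⁻¹ := by
    have h3 : ∫ _ in Set.Ioc (b : ℝ)⁻¹ 1, (1 / 2 : ℝ) ≤ ∫ s in Set.Ioc (b : ℝ)⁻¹ 1, (1 + s)⁻¹ := by
      refine setIntegral_mono_on (by simp) hint measurableSet_Ioc fun s hs => ?_
      rw [one_div]
      exact inv_anti₀ (by linarith [hs.1]) (by linarith [hs.2])
    refine lt_of_lt_of_le ?_ h3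
    simp [hb1.le]
    linarith
  have h3 : clogExpect t w * ∫ s in Set.Ioc (b : ℝ)⁻¹ 1, (1 + s)⁻¹ =
      ∫ s in Set.Ioc (b : ℝ)⁻¹ 1, ((1 + s)⁻¹ * clogExpect t w - (1 + s)⁻¹ * clogExpect s w) := by
    rw [integral_sub (hint.mul_const _) h1, h2, integral_mul_const]; ring
  refine le_of_mul_le_mul_right ?_ hW
  rw [← abs_of_pos hW, ← abs_mul, abs_of_pos hW, h3, ← integral_const_mul, ← Real.norm_eq_abs]
  refine norm_integral_le_of_norm_le (hint.const_mul _) ?_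
  filter_upwards [ae_restrict_mem measurableSet_Ioc] with s hs
  have hs0 : 0 ≤ s := hbpos.le.trans hs.1.le
  rw [← mul_sub, Real.norm_eq_abs, abs_mul, abs_of_nonneg (by positivity), mul_comm]
  exact mul_le_mul_of_nonneg_right (hη s ⟨hs0, hs.2⟩ t ht) (by positivity)

lemma integrableOn_comp_iterate (hb : 2 ≤ b) {w : ℝ → ℝ} (hw : IntegrableOn w (Set.Ioo 0 1))
    (n : ℕ) : IntegrableOn (w ∘ (clogMap b)^[n]) (Set.Ioo 0 1) :=
  memLp_one_iff_integrable.1 (memLp_comp_iterate_clogMap hb (memLp_one_iff_integrable.2 hw) n)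

lemma contraction_nonneg (hb : 2 ≤ b) : 0 ≤ 1 - 1 / (4 * (b : ℝ)) := by
  have hb' : (2 : ℝ) ≤ b := by exact_mod_cast hb
  rw [sub_nonneg, div_le_one (by positivity)]; linarith

/-- Exponential mixing: expectations along the orbit forget the initial density. -/
lemma abs_clogExpect_iterate_sub_le (hb : 2 ≤ b) {w : ℝ → ℝ} (hw : IntegrableOn w (Set.Ioo 0 1))
    (n : ℕ) : ∀ s ∈ Set.Icc (0 : ℝ) 1, ∀ t ∈ Set.Icc (0 : ℝ) 1,
    |clogExpect t (w ∘ (clogMap b)^[n]) - clogExpect s (w ∘ (clogMap b)^[n])| ≤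
      ((1 - 1 / (4 * b)) ^ n * (4 * ∫ x in Set.Ioo 0 1, |w x|)) * |t - s| := by
  induction n with
  | zero =>
    intro s hs t ht
    simpa using abs_clogExpect_sub_le hs ht hw
  | succ n ih =>
    intro s hs t ht
    have e : w ∘ (clogMap b)^[n + 1] = (w ∘ (clogMap b)^[n]) ∘ clogMap b := by
      rw [Function.iterate_succ, Function.comp_assoc]
    have hi := integrableOn_comp_iterate hb hw (n + 1)
    rw [e] at hi ⊢
    rw [pow_succ', mul_assoc (1 - 1 / (4 * (b : ℝ)))]
    exact abs_sub_le_of_hasSum_weight hb ih hs ht (hasSum_clogExpect_comp hb hs hi)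
      (hasSum_clogExpect_comp hb ht hi)

lemma abs_clogExpect_iterate_le (hb : 2 ≤ b) {w : ℝ → ℝ} (hw : IntegrableOn w (Set.Ioo 0 1))
    (h0 : ∫ x, w x ∂clogMeasure b = 0) (n : ℕ) {t : ℝ} (ht : t ∈ Set.Icc (0 : ℝ) 1) :
    |clogExpect t (w ∘ (clogMap b)^[n])| ≤
      (1 - 1 / (4 * b)) ^ n * (4 * ∫ x in Set.Ioo 0 1, |w x|) := by
  refine abs_clogExpect_le_of_integral_eq_zero hb (integrableOn_comp_iterate hb hw n) ?_ ?_ ht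
  · rw [integral_comp_iterate_clogMap hb (Integrable.mono_measure hw clogMeasure_le).1, h0]
  · intro s hs t ht
    refine (abs_clogExpect_iterate_sub_le hb hw n s hs t ht).trans (mul_le_of_le_one_right ?_ ?_)
    · have := contraction_nonneg hb
      have : 0 ≤ ∫ x in Set.Ioo 0 1, |w x| := integral_nonneg fun x => abs_nonneg (w x)
      positivity
    · exact abs_le.2 ⟨by linarith [hs.2, ht.1], by linarith [hs.1, ht.2]⟩

lemma abs_clogExpect_comp_iterate_le (hb : 2 ≤ b) {w : ℝ → ℝ}
    (hw : IntegrableOn w (Set.Ioo 0 1)) {K : ℝ}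
    (hK : ∀ t ∈ Set.Icc (0 : ℝ) 1, |clogExpect t w| ≤ K) (n : ℕ) :
    ∀ t ∈ Set.Icc (0 : ℝ) 1, |clogExpect t (w ∘ (clogMap b)^[n])| ≤ K := by
  induction n with
  | zero => simpa using hK
  | succ n ih =>
    intro t ht
    have e : w ∘ (clogMap b)^[n + 1] = (w ∘ (clogMap b)^[n]) ∘ clogMap b := by
      rw [Function.iterate_succ, Function.comp_assoc]
    have hi := integrableOn_comp_iterate hb hw (n + 1)
    rw [e] at hi ⊢
    have h := (hasSum_weight hb ht.1).mul_right K
    rw [one_mul] at h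
    rw [← Real.norm_eq_abs]
    refine (hasSum_clogExpect_comp hb ht hi).norm_le_of_bounded h fun i => ?_
    rw [Real.norm_eq_abs, abs_mul, abs_of_nonneg (i.weight_nonneg ht.1)]
    exact mul_le_mul_of_nonneg_left (ih _ (i.param_mem ht)) (i.weight_nonneg ht.1)

/-- Covariances of a function of the first digit along the orbit decay exponentially. -/
lemma abs_integral_mul_iterate_le (hb : 2 ≤ b) {u : ℝ → ℝ} {g : ClogDigit b → ℝ}
    (hu : ∀ i, ∀ x ∈ Set.Ioo (0 : ℝ) 1, u (i.branch x) = g i)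
    (hu2 : MemLp u 2 (volume.restrict (Set.Ioo 0 1))) (h0 : ∫ x, u x ∂clogMeasure b = 0)
    (m n : ℕ) :
    |∫ x in Set.Ioo 0 1, u ((clogMap b)^[m] x) * u ((clogMap b)^[m + (n + 1)] x)| ≤
      (1 - 1 / (4 * b)) ^ n * (8 * (∫ x in Set.Ioo 0 1, |u x|) ^ 2) := by
  set I := ∫ x in Set.Ioo 0 1, |u x|
  have hI : 0 ≤ I := integral_nonneg fun x => abs_nonneg (u x)
  have hu1 : IntegrableOn u (Set.Ioo 0 1) := hu2.integrable (by norm_num)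
  have hprod : IntegrableOn (fun x => u x * u ((clogMap b)^[n + 1] x)) (Set.Ioo 0 1) :=
    hu2.integrable_mul (memLp_comp_iterate_clogMap hb hu2 (n + 1))
  have hρ := contraction_nonneg hb
  have key : ∀ t ∈ Set.Icc (0 : ℝ) 1,
      |clogExpect t fun x => u x * u ((clogMap b)^[n + 1] x)| ≤
        (1 - 1 / (4 * b)) ^ n * (8 * I ^ 2) := by
    intro t ht
    -- condition on the first digit and apply the decay of expectations to the rest of the orbit
    have h1 := hasSum_clogExpect hb ht hu (w := u ∘ (clogMap b)^[n]) hprod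
    have h2 := hasSum_clogExpect hb ht (u := fun x => |u x|) (g := fun i => |g i|)
      (w := fun _ => 1) (fun i x hx => by rw [hu i x hx]) (by simp only [mul_one]; exact hu1.abs)
    have h3 : HasSum (fun i : ClogDigit b => i.weight t * |g i| *
        ((1 - 1 / (4 * b)) ^ n * (4 * I)))
        (clogExpect t (fun x => |u x|) * ((1 - 1 / (4 * b)) ^ n * (4 * I))) := by
      simp only [mul_one] at h2
      refine (h2.mul_right _).congr_fun fun i => ?_
      rw [clogExpect_one (i.param_mem ht).1, mul_one]
    have h4 := clogExpect_abs_le ht hu1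
    calc |clogExpect t fun x => u x * u ((clogMap b)^[n + 1] x)|
        ≤ clogExpect t (fun x => |u x|) * ((1 - 1 / (4 * b)) ^ n * (4 * I)) := by
          rw [← Real.norm_eq_abs]
          refine h1.norm_le_of_bounded h3 fun i => ?_
          rw [Real.norm_eq_abs, abs_mul, abs_mul, abs_of_nonneg (i.weight_nonneg ht.1)]
          exact mul_le_mul_of_nonneg_left (abs_clogExpect_iterate_le hb hu1 h0 n (i.param_mem ht))
            (mul_nonneg (i.weight_nonneg ht.1) (abs_nonneg _))
      _ ≤ 2 * I * ((1 - 1 / (4 * b)) ^ n * (4 * I)) :=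
          mul_le_mul_of_nonneg_right h4 (by positivity)
      _ = _ := by ring
  -- Lebesgue measure is the case `t = 0`, and the Markov property carries the bound through the
  -- first `m` steps
  have h5 := abs_clogExpect_comp_iterate_le hb hprod key m 0 (by simp)
  rw [clogExpect_zero] at h5
  have e (x : ℝ) : (clogMap b)^[m + (n + 1)] x = (clogMap b)^[n + 1] ((clogMap b)^[m] x) := by
    rw [add_comm, Function.iterate_add_apply]
  simp_rw [e]
  exact h5

end decay

/-! ### A law of large numbers under decay of covariances -/

section strongLaw

variable {Ω : Type*} [MeasurableSpace Ω] {μ : Measure Ω}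

lemma ae_tendsto_zero_of_summable_integral {F : ℕ → Ω → ℝ} (hF : ∀ n, Integrable (F n) μ)
    (h0 : ∀ n x, 0 ≤ F n x) (hs : Summable fun n => ∫ x, F n x ∂μ) :
    ∀ᵐ x ∂μ, Tendsto (fun n => F n x) atTop (𝓝 0) := by
  -- the series of the functions has finite integral, hence converges almost everywhere
  have h1 : ∫⁻ x, ∑' n, ENNReal.ofReal (F n x) ∂μ ≠ ⊤ := by
    rw [lintegral_tsum fun n => (hF n).1.aemeasurable.ennreal_ofReal]
    simp_rw [fun n => (ofReal_integral_eq_lintegral_ofReal (hF n) (ae_of_all _ (h0 n))).symm]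
    exact hs.tsum_ofReal_ne_top
  have h2 := ae_lt_top' (AEMeasurable.tsum
    fun n => (hF n).1.aemeasurable.ennreal_ofReal) h1
  filter_upwards [h2] with x hx
  have h3 := ENNReal.tendsto_atTop_zero_of_tsum_ne_top hx.ne
  have h4 := (ENNReal.tendsto_toReal ENNReal.zero_ne_top).comp h3
  simpa [Function.comp_def, ENNReal.toReal_ofReal (h0 _ x)] using h4

lemma integral_sq_sum_le {Z : ℕ → Ω → ℝ} {K ρ : ℝ} (hρ0 : 0 ≤ ρ) (hρ : ρ < 1)
    (hZ : ∀ n, MemLp (Z n) 2 μ) (hvar : ∀ n, ∫ x, Z n x ^ 2 ∂μ ≤ K)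
    (hcov : ∀ m n, |∫ x, Z m x * Z (m + (n + 1)) x ∂μ| ≤ ρ ^ n * K) (N : ℕ) :
    ∫ x, (∑ n ∈ Finset.range N, Z n x) ^ 2 ∂μ ≤ (K + 2 * (K / (1 - ρ))) * N := by
  have hK : 0 ≤ K := le_trans (integral_nonneg fun x => sq_nonneg _) (hvar 0)
  induction N with
  | zero => simp
  | succ N ih =>
    have hS : MemLp (fun x => ∑ n ∈ Finset.range N, Z n x) 2 μ := memLp_finsetSum _ fun n _ => hZ n
    have hcross : ∫ x, (∑ n ∈ Finset.range N, Z n x) * Z N x ∂μ ≤ K / (1 - ρ) := by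
      have hint (n : ℕ) : Integrable (fun x => Z n x * Z N x) μ := (hZ n).integrable_mul (hZ N)
      simp_rw [Finset.sum_mul]
      rw [integral_finsetSum _ fun n _ => hint n]
      calc ∑ n ∈ Finset.range N, ∫ x, Z n x * Z N x ∂μ
          ≤ ∑ n ∈ Finset.range N, ρ ^ (N - 1 - n) * K := by
            refine Finset.sum_le_sum fun n hn => ?_
            have h := hcov n (N - 1 - n)
            have e : n + (N - 1 - n + 1) = N := by have := Finset.mem_range.1 hn; omega
            rw [e] at h
            exact (le_abs_self _).trans h
        _ = (∑ n ∈ Finset.range N, ρ ^ n) * K := by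
            rw [← Finset.sum_mul, Finset.sum_range_reflect (fun n => ρ ^ n) N]
        _ ≤ (1 - ρ)⁻¹ * K := by
            refine mul_le_mul_of_nonneg_right ?_ hK
            rw [← tsum_geometric_of_lt_one hρ0 hρ]
            exact (summable_geometric_of_lt_one hρ0 hρ).sum_le_tsum _
              fun n _ => pow_nonneg hρ0 n
        _ = K / (1 - ρ) := by ring
    have e : ∫ x, (∑ n ∈ Finset.range (N + 1), Z n x) ^ 2 ∂μ =
        ∫ x, (∑ n ∈ Finset.range N, Z n x) ^ 2 ∂μ +
          2 * ∫ x, (∑ n ∈ Finset.range N, Z n x) * Z N x ∂μ + ∫ x, Z N x ^ 2 ∂μ := by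
      have h2 : Integrable (fun x => (∑ n ∈ Finset.range N, Z n x) * Z N x) μ :=
        hS.integrable_mul (hZ N)
      have h3 : Integrable (fun x => (∑ n ∈ Finset.range N, Z n x) ^ 2 +
          2 * ((∑ n ∈ Finset.range N, Z n x) * Z N x)) μ := hS.integrable_sq.add (h2.const_mul 2)
      rw [← integral_const_mul, ← integral_add hS.integrable_sq (h2.const_mul 2),
        ← integral_add h3 (hZ N).integrable_sq]
      refine integral_congr_ae (ae_of_all _ fun x => ?_)
      simp only [Finset.sum_range_succ]
      ring
    rw [e]
    push_cast
    linarith [hvar N]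

/-- A strong law of large numbers for nonnegative random variables with common mean `c`,
bounded variances and exponentially decaying covariances. Chebyshev's inequality gives
convergence along the sequences `⌊a ^ n⌋`, and monotonicity of the partial sums fills the gaps. -/
lemma ae_tendsto_average_of_covariance_decay {Y : ℕ → Ω → ℝ} {c K ρ : ℝ} (hρ0 : 0 ≤ ρ)
    (hρ : ρ < 1) (hY : ∀ n, MemLp (fun x => Y n x - c) 2 μ) (hnn : ∀ᵐ x ∂μ, ∀ n, 0 ≤ Y n x)
    (hvar : ∀ n, ∫ x, (Y n x - c) ^ 2 ∂μ ≤ K)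
    (hcov : ∀ m n, |∫ x, (Y m x - c) * (Y (m + (n + 1)) x - c) ∂μ| ≤ ρ ^ n * K) :
    ∀ᵐ x ∂μ, Tendsto (fun N : ℕ => (∑ n ∈ Finset.range N, Y n x) / N) atTop (𝓝 c) := by
  have hK : 0 ≤ K := le_trans (integral_nonneg fun x => sq_nonneg _) (hvar 0)
  set A := K + 2 * (K / (1 - ρ))
  have hA : 0 ≤ A := by
    have : 0 < 1 - ρ := by linarith
    positivity
  have hsub {a : ℝ} (ha : 1 < a) : ∀ᵐ x ∂μ, Tendsto
      (fun n : ℕ => (∑ i ∈ Finset.range ⌊a ^ n⌋₊, Y i x) / ⌊a ^ n⌋₊) atTop (𝓝 c) := by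
    have hpos (n : ℕ) : (0 : ℝ) < ⌊a ^ n⌋₊ := by
      refine zero_lt_one.trans_le ?_
      simp only [Nat.one_le_cast, Nat.one_le_floor_iff, one_le_pow₀ ha.le]
    have hfloor (n : ℕ) : a ^ n / 2 ≤ ⌊a ^ n⌋₊ := by
      have h1 := Nat.lt_floor_add_one (a ^ n)
      have h2 : (1 : ℝ) ≤ ⌊a ^ n⌋₊ := by exact_mod_cast Nat.cast_pos.1 (hpos n)
      linarith
    have hS (N : ℕ) : MemLp (fun x => ∑ n ∈ Finset.range N, (Y n x - c)) 2 μ :=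
      memLp_finsetSum _ fun n _ => hY n
    have h1 := ae_tendsto_zero_of_summable_integral (μ := μ)
      (F := fun n x => (∑ i ∈ Finset.range ⌊a ^ n⌋₊, (Y i x - c)) ^ 2 / (⌊a ^ n⌋₊ : ℝ) ^ 2)
      (fun n => (hS _).integrable_sq.div_const _) (fun n x => by positivity) ?_
    · filter_upwards [h1] with x hx
      have h2 : Tendsto (fun n : ℕ =>
          |(∑ i ∈ Finset.range ⌊a ^ n⌋₊, Y i x) / (⌊a ^ n⌋₊ : ℝ) - c|) atTop (𝓝 0) := by
        have h3 := hx.sqrt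
        rw [Real.sqrt_zero] at h3
        refine h3.congr fun n => ?_
        have h4 := (hpos n).ne'
        rw [← div_pow, Real.sqrt_sq_eq_abs, Finset.sum_sub_distrib, Finset.sum_const,
          Finset.card_range, nsmul_eq_mul, sub_div, mul_div_cancel_left₀ _ h4]
      rw [← tendsto_sub_nhds_zero_iff]
      exact (tendsto_zero_iff_abs_tendsto_zero _).2 h2
    · have hgeo : Summable fun n : ℕ => 2 * A * a⁻¹ ^ n :=
        (summable_geometric_of_lt_one (by positivity) (inv_lt_one_of_one_lt₀ ha)).mul_left _
      refine hgeo.of_nonneg_of_le (fun n => integral_nonneg fun x => by positivity) fun n => ?_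
      rw [integral_div]
      calc (∫ x, (∑ i ∈ Finset.range ⌊a ^ n⌋₊, (Y i x - c)) ^ 2 ∂μ) / (⌊a ^ n⌋₊ : ℝ) ^ 2
          ≤ A * ⌊a ^ n⌋₊ / (⌊a ^ n⌋₊ : ℝ) ^ 2 := by
            gcongr
            exact integral_sq_sum_le hρ0 hρ hY hvar hcov _
        _ = A / ⌊a ^ n⌋₊ := by
            have h4 := (hpos n).ne'
            field_simp
        _ ≤ A / (a ^ n / 2) := div_le_div_of_nonneg_left hA (by positivity) (hfloor n)
        _ = 2 * A * a⁻¹ ^ n := by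
            rw [inv_pow]; field_simp
  obtain ⟨a, -, ha, hlim⟩ :
      ∃ a : ℕ → ℝ, StrictAnti a ∧ (∀ n : ℕ, 1 < a n) ∧ Tendsto a atTop (𝓝 1) :=
    exists_seq_strictAnti_tendsto (1 : ℝ)
  filter_upwards [ae_all_iff.2 fun k => hsub (ha k), hnn] with x hx hx0
  refine tendsto_div_of_monotone_of_tendsto_div_floor_pow _ _ ?_ a ha hlim hx
  intro m n hmn
  exact Finset.sum_le_sum_of_subset_of_nonneg (Finset.range_mono hmn) fun i _ _ => hx0 i

end strongLaw

/-! ### Digit functions and remainders -/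

section digitFunction

variable {b : ℕ}

/-- A function of the first digit of `1 / x`. -/
def firstDigitFun (b : ℕ) (f : ℕ → ℕ → ℝ) (x : ℝ) : ℝ :=
  f (clogExponent b x⁻¹) (clogCoeff b x⁻¹)

lemma firstDigitFun_branch (f : ℕ → ℕ → ℝ) (i : ClogDigit b) {x : ℝ}
    (hx : x ∈ Set.Ioo (0 : ℝ) 1) : firstDigitFun b f (i.branch x) = f i.1 (i.2 + 1) := by
  rw [firstDigitFun, clogExponent_branch i ⟨hx.1.le, hx.2⟩, clogCoeff_branch i ⟨hx.1.le, hx.2⟩]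

lemma measurable_firstDigitFun (f : ℕ → ℕ → ℝ) : Measurable (firstDigitFun b f) :=
  (measurable_from_prod_countable_right (f := fun p : ℕ × ℕ => f p.1 p.2)
    fun _ => measurable_from_nat).comp
    ((measurable_clogExponent.comp measurable_inv).prodMk (measurable_clogCoeff.comp measurable_inv))

lemma hasDerivAt_log_sub_log {x : ℝ} (hx : 0 ≤ x) (hb : 2 ≤ b) :
    HasDerivAt (fun x => Real.log (1 + x) - Real.log (b + x)) (clogDensity b x) x := by
  have hb' : (2 : ℝ) ≤ b := by exact_mod_cast hb
  exact (((hasDerivAt_id x).const_add 1).log (by simp only [id]; positivity)).sub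
    (((hasDerivAt_id x).const_add (b : ℝ)).log (by simp only [id]; positivity))

lemma continuousAt_clogDensity {x : ℝ} (hx : 0 ≤ x) (hb : 2 ≤ b) :
    ContinuousAt (clogDensity b) x := by
  have hb' : (2 : ℝ) ≤ b := by exact_mod_cast hb
  have h1 : 1 + x ≠ 0 := by positivity
  have h2 : (b : ℝ) + x ≠ 0 := by positivity
  unfold clogDensity
  fun_prop (disch := assumption)

lemma integral_one_clogMeasure (hb : 2 ≤ b) :
    ∫ _, (1 : ℝ) ∂clogMeasure b = Real.log (2 * b / (b + 1)) := by
  have hb' : (2 : ℝ) ≤ b := by exact_mod_cast hb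
  have hpos : ∀ x ∈ Set.uIcc (0 : ℝ) 1, 0 ≤ x := by
    intro x hx
    rw [Set.uIcc_of_le zero_le_one] at hx
    exact hx.1
  rw [integral_clogMeasure hb]
  simp only [mul_one]
  rw [← integral_Ioc_eq_integral_Ioo, ← intervalIntegral.integral_of_le zero_le_one,
    intervalIntegral.integral_eq_sub_of_hasDerivAt
      fun x hx => hasDerivAt_log_sub_log (hpos x hx) hb]
  · rw [Real.log_div (by positivity) (by positivity), Real.log_mul (by norm_num) (by positivity)]
    norm_num
    ring
  · exact ContinuousOn.intervalIntegrable fun x hx =>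
      (continuousAt_clogDensity (hpos x hx) hb).continuousWithinAt

lemma log_total_pos (hb : 2 ≤ b) : 0 < Real.log (2 * b / (b + 1)) := by
  have hb' : (2 : ℝ) ≤ b := by exact_mod_cast hb
  apply Real.log_pos
  rw [lt_div_iff₀ (by positivity)]
  linarith

/-- The invariant measure of the set of points with first digit `i`. -/
lemma integral_jacobian_mul_clogDensity (i : ClogDigit b) :
    ∫ x in Set.Ioo 0 1, (i.scale * (i.coeff + x) ^ 2)⁻¹ * clogDensity b (i.branch x) =
      clogDigitProb b i.1 (i.2 + 1) * Real.log (2 * b / (b + 1)) := by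
  have hb := i.two_le
  have hb' : (2 : ℝ) ≤ b := by exact_mod_cast hb
  have h1 := i.scale_pos
  have h2 := i.one_le_coeff
  have hpos : ∀ x ∈ Set.uIcc (0 : ℝ) 1, 0 ≤ x := by
    intro x hx
    rw [Set.uIcc_of_le zero_le_one] at hx
    exact hx.1
  have hbr {x : ℝ} (hx : 0 ≤ x) : 0 ≤ i.branch x := by unfold branch; positivity
  have hd : ∀ x ∈ Set.uIcc (0 : ℝ) 1, HasDerivAt
      (fun x => -(Real.log (1 + i.branch x) - Real.log (b + i.branch x)))
      ((i.scale * (i.coeff + x) ^ 2)⁻¹ * clogDensity b (i.branch x)) x := by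
    intro x hx
    have h := ((hasDerivAt_log_sub_log (hbr (hpos x hx)) hb).comp x
      (hasDerivAt_branch i (hpos x hx))).neg
    refine h.congr_deriv ?_
    ring
  rw [← integral_Ioc_eq_integral_Ioo, ← intervalIntegral.integral_of_le zero_le_one,
    intervalIntegral.integral_eq_sub_of_hasDerivAt hd]
  · have e0 : i.branch 0 = (((i.2 + 1 : ℕ) : ℝ))⁻¹ * ((b : ℝ) ^ i.1)⁻¹ := by
      simp [branch, scale, coeff, mul_comm]
    have e1 : i.branch 1 = (((i.2 + 1 : ℕ) : ℝ) + 1)⁻¹ * ((b : ℝ) ^ i.1)⁻¹ := by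
      simp [branch, scale, coeff, mul_comm]
    have h3 := hbr (le_refl 0)
    have h4 := hbr zero_le_one
    rw [clogDigitProb, div_mul_cancel₀ _ (log_total_pos hb).ne', ← e0, ← e1,
      Real.log_div (by positivity) (by positivity), Real.log_mul (by positivity) (by positivity),
      Real.log_mul (by positivity) (by positivity)]
    ring
  · refine ContinuousOn.intervalIntegrable fun x hx => ContinuousAt.continuousWithinAt ?_
    have h5 : i.scale * (i.coeff + x) ^ 2 ≠ 0 := by have := hpos x hx; positivity
    exact ContinuousAt.mul (by fun_prop (disch := assumption))
      (ContinuousAt.comp (continuousAt_clogDensity (hbr (hpos x hx)) hb)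
        (hasDerivAt_branch i (hpos x hx)).continuousAt)

lemma hasSum_clogDigitProb (hb : 2 ≤ b) {f : ℕ → ℕ → ℝ}
    (hf : IntegrableOn (firstDigitFun b f) (Set.Ioo 0 1)) :
    HasSum (fun i : ClogDigit b => f i.1 (i.2 + 1) * clogDigitProb b i.1 (i.2 + 1))
      ((∫ x, firstDigitFun b f x ∂clogMeasure b) / Real.log (2 * b / (b + 1))) := by
  have hint : IntegrableOn (fun x => clogDensity b x * firstDigitFun b f x) (Set.Ioo 0 1) := by
    refine Integrable.bdd_mul (c := 1) hf measurable_clogDensity.aestronglyMeasurable ?_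
    filter_upwards [ae_restrict_mem measurableSet_Ioo] with x hx
    rw [Real.norm_eq_abs, abs_of_nonneg (by linarith [le_clogDensity hb hx])]
    exact clogDensity_le_one hx
  have h := hasSum_integral_branch hb hint
  rw [← integral_clogMeasure hb] at h
  refine (h.div_const _).congr_fun fun i => ?_
  have e : ∫ x in Set.Ioo 0 1, (i.scale * (i.coeff + x) ^ 2)⁻¹ *
      (clogDensity b (i.branch x) * firstDigitFun b f (i.branch x)) =
      clogDigitProb b i.1 (i.2 + 1) * Real.log (2 * b / (b + 1)) * f i.1 (i.2 + 1) := by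
    rw [← integral_jacobian_mul_clogDensity, ← integral_mul_const]
    refine setIntegral_congr_fun measurableSet_Ioo fun x hx => ?_
    rw [firstDigitFun_branch f i hx, mul_assoc]
  rw [e]
  have := (log_total_pos hb).ne'
  field_simp

lemma hasSum_sum_Icc_clogDigitProb (hb : 2 ≤ b) {f : ℕ → ℕ → ℝ}
    (hf : IntegrableOn (firstDigitFun b f) (Set.Ioo 0 1)) :
    HasSum (fun k : ℕ => ∑ l ∈ Finset.Icc 1 (b - 1), f k l * clogDigitProb b k l)
      ((∫ x, firstDigitFun b f x ∂clogMeasure b) / Real.log (2 * b / (b + 1))) := by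
  refine (hasSum_clogDigitProb hb hf).prod_fiberwise fun k => ?_
  have e : ∑ l ∈ Finset.Icc 1 (b - 1), f k l * clogDigitProb b k l =
      ∑ j : Fin (b - 1), f k (j + 1) * clogDigitProb b k (j + 1) := by
    rw [Fin.sum_univ_eq_sum_range (fun j => f k (j + 1) * clogDigitProb b k (j + 1)),
      Finset.range_eq_Ico, Finset.sum_Ico_add' (fun l => f k l * clogDigitProb b k l)]
    congr 1
  rw [e]
  exact hasSum_fintype _

/-- A digit function that grows more slowly than the square root of the term is square
integrable, because the first term of `1 / x` is at most `1 / x`. -/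
lemma memLp_firstDigitFun (hb : 2 ≤ b) {f : ℕ → ℕ → ℝ} {C δ : ℝ} (hδ : 0 < δ)
    (hf_nonneg : ∀ s t : ℕ, 1 ≤ t → t ≤ b - 1 → 0 ≤ f s t)
    (hf_lt : ∀ s t : ℕ, 1 ≤ t → t ≤ b - 1 →
      f s t < C * ((t : ℝ) * (b : ℝ) ^ s) ^ ((1 : ℝ) / 2 - δ)) :
    MemLp (firstDigitFun b f) 2 (volume.restrict (Set.Ioo 0 1)) := by
  -- the minimum keeps the exponent nonnegative when `1 / 2 < δ`
  set r : ℝ := 1 / 2 - min δ (1 / 2)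
  have hr0 : 0 ≤ r := sub_nonneg.2 (min_le_right _ _)
  have hr1 : r < 1 / 2 := sub_lt_self _ (lt_min hδ (by norm_num))
  have hdom : MemLp (fun x : ℝ => C * x ^ (-r)) 2 (volume.restrict (Set.Ioo 0 1)) := by
    refine MemLp.const_mul ?_ C
    rw [memLp_two_iff_integrable_sq (Measurable.aestronglyMeasurable (by fun_prop))]
    have h : IntegrableOn (fun x : ℝ => x ^ (-(2 * r))) (Set.Ioo 0 1) :=
      (intervalIntegral.integrableOn_Ioo_rpow_iff zero_lt_one).2 (by linarith)
    refine h.congr_fun (fun x hx => ?_) measurableSet_Ioo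
    simp only
    rw [← Real.rpow_natCast, ← Real.rpow_mul hx.1.le]
    congr 1
    push_cast
    ring
  refine hdom.mono (measurable_firstDigitFun f).aestronglyMeasurable ?_
  filter_upwards [ae_restrict_mem measurableSet_Ioo] with x hx
  have hy : 1 ≤ x⁻¹ := (one_le_inv₀ hx.1).2 hx.2.le
  obtain ⟨hc1, hc2⟩ := clogCoeff_mem hb hy
  have hnn := hf_nonneg (clogExponent b x⁻¹) _ hc1 hc2
  have hlt := hf_lt (clogExponent b x⁻¹) _ hc1 hc2
  set m : ℝ := (clogCoeff b x⁻¹ : ℝ) * (b : ℝ) ^ clogExponent b x⁻¹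
  have hB : (1 : ℝ) ≤ (b : ℝ) ^ clogExponent b x⁻¹ :=
    one_le_pow₀ (by exact_mod_cast (by omega : 1 ≤ b))
  have hm1 : 1 ≤ m := one_le_mul_of_one_le_of_one_le (by exact_mod_cast hc1) hB
  have hm2 : m ≤ x⁻¹ := by
    rw [← le_div_iff₀ (by linarith)]
    exact Nat.floor_le (by have := hx.1; positivity)
  have hC : 0 < C := by
    have : 0 < C * m ^ ((1 : ℝ) / 2 - δ) := hnn.trans_lt hlt
    exact pos_of_mul_pos_left this (by positivity)
  have h1 : m ^ ((1 : ℝ) / 2 - δ) ≤ m ^ r :=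
    Real.rpow_le_rpow_of_exponent_le hm1 (sub_le_sub_left (min_le_left _ _) _)
  have h2 : m ^ r ≤ x ^ (-r) := by
    rw [Real.rpow_neg hx.1.le, ← Real.inv_rpow hx.1.le]
    exact Real.rpow_le_rpow (by linarith) hm2 hr0
  rw [Real.norm_eq_abs, Real.norm_eq_abs, firstDigitFun, abs_of_nonneg hnn,
    abs_of_nonneg (mul_nonneg hC.le (Real.rpow_nonneg hx.1.le _))]
  exact hlt.le.trans (mul_le_mul_of_nonneg_left (h1.trans h2) hC.le)

/-- Along almost every orbit of the continued logarithm map, the averages of a square integrable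
function of the first digit converge to its mean under the normalized invariant measure. -/
lemma ae_tendsto_average_firstDigitFun (hb : 2 ≤ b) {f : ℕ → ℕ → ℝ}
    (hf_nonneg : ∀ s t : ℕ, 1 ≤ t → t ≤ b - 1 → 0 ≤ f s t)
    (hf : MemLp (firstDigitFun b f) 2 (volume.restrict (Set.Ioo 0 1))) :
    ∀ᵐ x ∂volume.restrict (Set.Ioo (0 : ℝ) 1), Tendsto
      (fun N : ℕ => (∑ n ∈ Finset.range N, firstDigitFun b f ((clogMap b)^[n] x)) / N) atTop
      (𝓝 ((∫ x, firstDigitFun b f x ∂clogMeasure b) / Real.log (2 * b / (b + 1)))) := by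
  set c := (∫ x, firstDigitFun b f x ∂clogMeasure b) / Real.log (2 * b / (b + 1)) with hc
  set u : ℝ → ℝ := fun x => firstDigitFun b f x - c
  have hu2 : MemLp u 2 (volume.restrict (Set.Ioo 0 1)) := hf.sub (memLp_const c)
  have hu0 : ∫ x, u x ∂clogMeasure b = 0 := by
    have h1 : Integrable (firstDigitFun b f) (clogMeasure b) :=
      Integrable.mono_measure (hf.integrable (by norm_num)) clogMeasure_le
    have h2 := integral_one_clogMeasure hb
    have h3 := integral_const_mul (μ := clogMeasure b) c (fun _ => (1 : ℝ))
    simp only [mul_one] at h3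
    rw [integral_sub h1 (integrable_const c), h3, h2, hc, div_mul_cancel₀ _ (log_total_pos hb).ne',
      sub_self]
  have hb' : (2 : ℝ) ≤ b := by exact_mod_cast hb
  have hρ : 1 - 1 / (4 * (b : ℝ)) < 1 := sub_lt_self _ (by positivity)
  set I := ∫ x in Set.Ioo 0 1, |u x|
  set J := ∫ x in Set.Ioo 0 1, u x ^ 2
  refine ae_tendsto_average_of_covariance_decay (K := max (8 * I ^ 2) (6 * J))
    (contraction_nonneg hb) hρ (memLp_comp_iterate_clogMap hb hu2) ?_ ?_ ?_
  · filter_upwards [ae_iterate_clogMap_mem_Ioo hb] with x hx n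
    have h := clogCoeff_mem hb ((one_le_inv₀ (hx n).1).2 (hx n).2.le)
    exact hf_nonneg _ _ h.1 h.2
  · intro n
    exact (integral_comp_iterate_clogMap_le hb (v := fun x => u x ^ 2) (fun x => sq_nonneg _)
      hu2.integrable_sq n).trans (le_max_right _ _)
  · intro m n
    refine (abs_integral_mul_iterate_le hb (g := fun i => f i.1 (i.2 + 1) - c)
      (fun i x hx => ?_) hu2 hu0 m n).trans ?_
    · rw [← firstDigitFun_branch f i hx]
    · exact mul_le_mul_of_nonneg_left (le_max_left _ _) (pow_nonneg (contraction_nonneg hb) n)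

end digitFunction

section remainders

variable {b : ℕ}

lemma clogDigits_of_mem_Ioo (hb : 2 ≤ b) {α : ℝ} (hα : α ∈ Set.Ioo (1 : ℝ) 2) :
    clogExponent b α = 0 ∧ clogCoeff b α = 1 := by
  have hb' : (2 : ℝ) ≤ b := by exact_mod_cast hb
  have h : clogExponent b α = 0 :=
    clogExponent_eq hb (by simpa using hα.1.le) (by simpa using hα.2.trans_le hb')
  refine ⟨h, ?_⟩
  rw [clogCoeff, h, pow_zero, div_one, Nat.floor_eq_iff (by linarith [hα.1])]
  norm_num
  exact ⟨hα.1.le, hα.2⟩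

/-- After the first term, which is `1`, the remainders are the reciprocals of the orbit of
`α - 1` under the continued logarithm map. -/
lemma clogRemainder_succ (hb : 2 ≤ b) {α : ℝ} (hα : α ∈ Set.Ioo (1 : ℝ) 2) (n : ℕ) :
    clogRemainder b α (n + 1) = ((clogMap b)^[n] (α - 1))⁻¹ := by
  induction n with
  | zero =>
    obtain ⟨h1, h2⟩ := clogDigits_of_mem_Ioo hb hα
    simp [clogRemainder, h1, h2]
  | succ n ih =>
    rw [clogRemainder, ih, Function.iterate_succ_apply', clogMap]
    have hpos : (b : ℝ) ^ clogExponent b ((clogMap b)^[n] (α - 1))⁻¹ ≠ 0 :=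
      pow_ne_zero _ (by exact_mod_cast (by omega : b ≠ 0))
    rw [← inv_div, sub_div, mul_div_cancel_right₀ _ hpos]

end remainders

end

theorem mainTheorem7 (b : ℕ) (hb : 2 ≤ b) (f : ℕ → ℕ → ℝ) (C δ : ℝ) (hC : 0 < C) (hδ : 0 < δ)
    (hf_nonneg : ∀ s t : ℕ, 1 ≤ t → t ≤ b - 1 → 0 ≤ f s t)
    (hf_lt : ∀ s t : ℕ, 1 ≤ t → t ≤ b - 1 →
      f s t < C * ((t : ℝ) * (b : ℝ) ^ s) ^ ((1 : ℝ) / 2 - δ)) :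
    Summable (fun k : ℕ => ∑ l ∈ Finset.Icc 1 (b - 1), f k l * clogDigitProb b k l) ∧
    ∀ᵐ α ∂(volume.restrict (Set.Ioo (1 : ℝ) 2)),
      ¬ ClogTerminates b α ∧
      Tendsto
        (fun N : ℕ => (1 / (N : ℝ)) * ∑ n ∈ Finset.Icc 1 N, f (clogA b α n) (clogC b α n))
        atTop
        (𝓝 (∑' k : ℕ, ∑ l ∈ Finset.Icc 1 (b - 1), f k l * clogDigitProb b k l)) := by
  have hf := memLp_firstDigitFun hb hδ hf_nonneg hf_lt
  have hsum := hasSum_sum_Icc_clogDigitProb hb (hf.integrable (by norm_num))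
  refine ⟨hsum.summable, ?_⟩
  rw [hsum.tsum_eq]
  have hpre : (fun α : ℝ => α - 1) ⁻¹' Set.Ioo 0 1 = Set.Ioo 1 2 := by
    ext α
    simp only [Set.mem_preimage, Set.mem_Ioo]
    constructor <;> rintro ⟨h1, h2⟩ <;> constructor <;> linarith
  have hmp := (measurePreserving_sub_right (volume : Measure ℝ) 1).restrict_preimage
    (measurableSet_Ioo (a := (0 : ℝ)) (b := 1))
  rw [hpre] at hmp
  have hae := hmp.quasiMeasurePreserving.ae
    ((ae_iterate_clogMap_mem_Ioo hb).and (ae_tendsto_average_firstDigitFun hb hf_nonneg hf))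
  filter_upwards [hae, ae_restrict_mem measurableSet_Ioo] with α ⟨hmem, hlim⟩ hα
  constructor
  · rintro ⟨n, hn⟩
    cases n with
    | zero =>
      obtain ⟨h1, h2⟩ := clogDigits_of_mem_Ioo hb hα
      simp only [clogC, clogA, clogRemainder, h1, h2] at hn
      norm_num at hn
      exact hα.1.ne' hn
    | succ n =>
      -- the expansion stops exactly when the orbit reaches `0`
      have h0 := (hmem (n + 1)).1
      simp only [clogC, clogA, clogRemainder_succ hb hα] at hn
      have hpos : (b : ℝ) ^ clogExponent b ((clogMap b)^[n] (α - 1))⁻¹ ≠ 0 :=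
        pow_ne_zero _ (by exact_mod_cast (by omega : b ≠ 0))
      rw [Function.iterate_succ_apply', clogMap, div_eq_of_eq_mul hpos hn, sub_self] at h0
      exact lt_irrefl _ h0
  · refine hlim.congr fun N => ?_
    have hN : Finset.Icc 1 N = Finset.Ico (0 + 1) (N + 1) := by
      ext n
      simp only [Finset.mem_Icc, Finset.mem_Ico]
      omega
    rw [one_div, inv_mul_eq_div, hN, Finset.range_eq_Ico,
      ← Finset.sum_Ico_add' (fun n => f (clogA b α n) (clogC b α n)) 0 N 1]
    simp only [firstDigitFun, clogA, clogC, clogRemainder_succ hb hα]
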